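/- Let $G$ be a bounded domain in $\mathbb C^n$ ($n\ge 2$), and let $D\Subset G$ (that is, $\overline D$ is a compact subset of $G$) be a domain with $\mathcal C^2$-smooth boundary such that at each boundary point of $D$ the Levi form of $D$, restricted to the complex tangent space, has at least one positive eigenvalue. For a domain $\Omega\subset\mathbb C^n$ let $k_\Omega$ be its Kobayashi distance, i.e. the largest pseudodistance on $\Omega$ not exceeding the Lempert function $$l_\Omega(z,w)=\inf\{\tanh^{-1}|\alpha| : \alpha\in\mathbb D,\ \exists\,\varphi:\mathbb D\to\Omega\text{ holomorphic with }\varphi(0)=z,\ \varphi(\alpha)=w\},$$ where $\mathbb D$ is the unit disc and $\inf\emptyset=\infty$. Then $G'=G\setminus\overline D$ is a domain, $k_G$ and $k_{G'}$ are distances (on $G$ and on $G'$), and $k_{G'}$ is quasi-isometrically equivalent to $k_G|_{G'\times G'}$: there are constants $c_1,c_2>0$ such that $$c_1^{-1}k_{G'}(z,w)-c_2\le k_G(z,w)\le c_1k_{G'}(z,w)+c_2,\qquad z,w\in G'.$$ In particular, if $(G,k_G)$ is Gromov hyperbolic, then so is $(G',k_{G'})$. Here a metric space $(X,d)$ is called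 Gromov hyperbolic if $$\sup_{p,q,x,w\in X}\bigl(\min\{(p,x)_w,(x,q)_w\}-(p,q)_w\bigr)<\infty,\qquad (x,y)_z=d(x,z)+d(z,y)-d(x,y).$$ -/

import Mathlib

open scoped ENNReal

noncomputable section

/-! ### Distances, quasi-isometries and Gromov hyperbolicity -/

/-- `d` is a distance (metric) on `X`. -/
structure IsDistance {X : Type*} (d : X → X → ℝ) : Prop where
  self_eq_zero : ∀ x, d x x = 0
  pos : ∀ x y, x ≠ y → 0 < d x y
  symm : ∀ x y, d x y = d y x
  triangle : ∀ x y z, d x z ≤ d x y + d y z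

/-- `φ : (X, d₁) → (Y, d₂)` is a quasi-isometry (no coarse surjectivity is required). -/
def IsQuasiIsometry {X Y : Type*} (d₁ : X → X → ℝ) (d₂ : Y → Y → ℝ) (φ : X → Y) : Prop :=
  ∃ c₁ c₂ : ℝ, 0 < c₁ ∧ 0 < c₂ ∧ ∀ x y : X,
    c₁⁻¹ * d₁ x y - c₂ ≤ d₂ (φ x) (φ y) ∧ d₂ (φ x) (φ y) ≤ c₁ * d₁ x y + c₂

/-- Two distances on the same set are quasi-isometrically equivalent if the identity map
is a quasi-isometry. -/
def QuasiIsometricallyEquivalent {X : Type*} (d₁ d₂ : X → X → ℝ) : Prop :=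
  IsQuasiIsometry d₁ d₂ id

/-- The Gromov product `(x, y)_z` (without the factor `1 / 2`). -/
def gromovProduct {X : Type*} (d : X → X → ℝ) (x y z : X) : ℝ :=
  d x z + d z y - d x y

/-- `S_d(p, q, x, w) = min {(p, x)_w, (x, q)_w} - (p, q)_w`. -/
def gromovDefect {X : Type*} (d : X → X → ℝ) (p q x w : X) : ℝ :=
  min (gromovProduct d p x w) (gromovProduct d x q w) - gromovProduct d p q w

/-- `(X, d)` is Gromov hyperbolic: the supremum of `S_d` over all quadruples is finite. -/
def IsGromovHyperbolic {X : Type*} (d : X → X → ℝ) : Prop :=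
  ∃ M : ℝ, ∀ p q x w : X, gromovDefect d p q x w ≤ M

/-! ### The Lempert function and the Kobayashi distance -/

/-- The Lempert function of `D`: the infimum of `artanh |α|` over all holomorphic maps `φ` from the
unit disc to `D` with `φ 0 = z` and `φ α = w`, where `α` is in the unit disc. It is `∞` if there is
no such map. -/
def lempertFunction {n : ℕ} (D : Set (EuclideanSpace ℂ (Fin n))) (z w : D) : ℝ≥0∞ :=
  ⨅ (φ : ℂ → EuclideanSpace ℂ (Fin n)) (α : ℂ)
    (_ : DifferentiableOn ℂ φ (Metric.ball 0 1))
    (_ : Set.MapsTo φ (Metric.ball 0 1) D)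
    (_ : α ∈ Metric.ball (0 : ℂ) 1) (_ : φ 0 = z) (_ : φ α = w),
    ENNReal.ofReal (Real.artanh ‖α‖)

/-- The largest pseudodistance on `D`, with values in `[0, ∞]`, that does not exceed the Lempert
function. (All of its values are finite if `D` is a domain.) -/
def kobayashiEDist {n : ℕ} (D : Set (EuclideanSpace ℂ (Fin n))) (z w : D) : ℝ≥0∞ :=
  ⨆ (δ : PseudoMetric D ℝ≥0∞) (_ : ∀ x y : D, δ x y ≤ lempertFunction D x y), δ z w

/-- The Kobayashi distance `k_D` of a domain `D` in `ℂⁿ`. -/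
def kobayashiDist {n : ℕ} (D : Set (EuclideanSpace ℂ (Fin n))) (z w : D) : ℝ :=
  (kobayashiEDist D z w).toReal

/-! ### Smooth boundaries and the Levi form -/

/-- `r` is a `C²` defining function of `D` near the point `p`. -/
def IsC2LocalDefiningFunction {n : ℕ} (D : Set (EuclideanSpace ℂ (Fin n)))
    (r : EuclideanSpace ℂ (Fin n) → ℝ) (p : EuclideanSpace ℂ (Fin n)) : Prop :=
  ∃ U : Set (EuclideanSpace ℂ (Fin n)), IsOpen U ∧ p ∈ U ∧ ContDiffOn ℝ 2 r U ∧
    fderiv ℝ r p ≠ 0 ∧ D ∩ U = {z ∈ U | r z < 0}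

/-- The boundary of `D` is `C²`-smooth. -/
def HasC2Boundary {n : ℕ} (D : Set (EuclideanSpace ℂ (Fin n))) : Prop :=
  ∀ p ∈ frontier D, ∃ r, IsC2LocalDefiningFunction D r p

/-- The complex tangent space at `p` of the level set of `r`: the vectors `X` with
`∑ⱼ ∂r/∂zⱼ(p) Xⱼ = 0`, that is, the maximal complex subspace of the kernel of `dr(p)`. -/
def complexTangentSpace {n : ℕ} (r : EuclideanSpace ℂ (Fin n) → ℝ)
    (p : EuclideanSpace ℂ (Fin n)) : Set (EuclideanSpace ℂ (Fin n)) :=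
  {X | fderiv ℝ r p X = 0 ∧ fderiv ℝ r p (Complex.I • X) = 0}

/-- The sesquilinear form `∑ⱼₖ ∂²r/∂zⱼ∂z̄ₖ(p) Xⱼ Ȳₖ`, written through the real second derivative
`H` of `r` at `p`. It is linear in `X` and conjugate-linear in `Y`. -/
def leviForm {n : ℕ} (r : EuclideanSpace ℂ (Fin n) → ℝ)
    (p X Y : EuclideanSpace ℂ (Fin n)) : ℂ :=
  let H : EuclideanSpace ℂ (Fin n) → EuclideanSpace ℂ (Fin n) → ℝ :=
    fun u v => fderiv ℝ (fderiv ℝ r) p u v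
  (1 / 4 : ℂ) * (((H X Y + H (Complex.I • X) (Complex.I • Y) : ℝ) : ℂ) +
    Complex.I * ((H X (Complex.I • Y) - H (Complex.I • X) Y : ℝ) : ℂ))

/-- The Levi form of `D` at the boundary point `p`, that is, the form `leviForm r p` of a local
defining function `r`, restricted to the complex tangent space, has a positive eigenvalue `μ`.
(A change of the defining function does not change the signs of the eigenvalues.) -/
def LeviFormHasPositiveEigenvalue {n : ℕ} (D : Set (EuclideanSpace ℂ (Fin n)))
    (p : EuclideanSpace ℂ (Fin n)) : Prop :=
  ∃ r, IsC2LocalDefiningFunction D r p ∧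
    ∃ μ : ℝ, 0 < μ ∧ ∃ X ∈ complexTangentSpace r p, X ≠ 0 ∧
      ∀ Y ∈ complexTangentSpace r p, leviForm r p X Y = (μ : ℂ) * inner ℂ Y X

end

open Set Metric Filter Topology

/-! Write `K = closure D` and `G' = G \ K`. Discs in `G'` are discs in `G`, so `k_G ≤ k_{G'}`
(`kobayashiEDist_mono`). The substance is the reverse bound `k_{G'} ≤ k_G + M`, with multiplicative
constant one (`exists_kobayashiDist_diff_closure_le`). It gives the quasi-isometry, and it changes
Gromov products only by a bounded amount, so hyperbolicity passes to `G'` without any stability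
theorem for quasi-geodesics.

The positive Levi eigenvalue makes every exterior point `z` near the boundary of `D` the centre of a
quadratic disc `z + t Y(z) + t² c` of uniform size that avoids `K` and reaches a fixed compact
subset of the exterior (`exists_exterior_discs`). This has two consequences. First, if `L` is a
compact neighbourhood of `K` in `G`, then `L \ K` is bounded for `k_{G'}`
(`exists_kobayashiLE_diff_closure`). Second, the complement of `K` has no bounded component, by the
mean value inequality for `‖·‖²` at a farthest point. That complement is therefore connected, and
`G'` is connected because a circle-valued function on `ℂⁿ` lifts to a real one
(`IsPreconnected.diff_of_isPreconnected_compl`).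

For the bound, join two points of `G'` by an almost length-minimizing chain of short discs in `G`. A
disc whose centre has distance at least `ρ` from `K` avoids `K` after shrinking by the factor `tanh
ρ`, which multiplies the cost by `1 + O(exp (-2ρ))`. Cut the chain at its first and last visits to
`L`, or at its point nearest to a base point if it never visits `L`. The outer parts recede from the
base point at least at half their length, up to a constant, so their extra costs have a bounded sum.
The middle part is replaced by a connection of bounded length in `G'`
(`exists_kobayashiLE_diff_of_kobayashiLE`). -/

/-! ### Discs and the Kobayashi pseudodistance -/

/-- `y` is reached from `x` inside `Ω` by a holomorphic disc, at hyperbolic distance `a`. -/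
def IsDiscStep {n : ℕ} (Ω : Set (EuclideanSpace ℂ (Fin n))) (x y : EuclideanSpace ℂ (Fin n))
    (a : ℝ) : Prop :=
  0 ≤ a ∧ ∃ φ : ℂ → EuclideanSpace ℂ (Fin n), DifferentiableOn ℂ φ (ball 0 1) ∧
    MapsTo φ (ball 0 1) Ω ∧ φ 0 = x ∧ φ (Real.tanh a : ℝ) = y

/-- `x` and `y` lie in `Ω`, at Kobayashi distance at most `T`. -/
def KobayashiLE {n : ℕ} (Ω : Set (EuclideanSpace ℂ (Fin n))) (x y : EuclideanSpace ℂ (Fin n))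
    (T : ℝ) : Prop :=
  ∃ (hx : x ∈ Ω) (hy : y ∈ Ω), kobayashiEDist Ω ⟨x, hx⟩ ⟨y, hy⟩ ≤ ENNReal.ofReal T

/-- `z` is reached from `x` by a chain of disc steps of lengths at most `ε` and of total
length `T`. -/
inductive DiscChain {n : ℕ} (Ω : Set (EuclideanSpace ℂ (Fin n))) (ε : ℝ)
    (x : EuclideanSpace ℂ (Fin n)) : EuclideanSpace ℂ (Fin n) → ℝ → Prop
  | nil (hx : x ∈ Ω) : DiscChain Ω ε x x 0
  | snoc {y z : EuclideanSpace ℂ (Fin n)} {T a : ℝ} (h : DiscChain Ω ε x y T)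
      (hs : IsDiscStep Ω y z a) (ha : a ≤ ε) : DiscChain Ω ε x z (T + a)

/-! ### Hyperbolic tangent and automorphisms of the disc -/

theorem tanh_mem_unitBall (a : ℝ) : ((Real.tanh a : ℝ) : ℂ) ∈ ball (0 : ℂ) 1 := by
  rw [mem_ball_zero_iff, Complex.norm_real, Real.norm_eq_abs, abs_lt]
  exact ⟨Real.neg_one_lt_tanh a, Real.tanh_lt_one a⟩

theorem tanh_add_formula (s t : ℝ) :
    Real.tanh (s + t) = (Real.tanh s + Real.tanh t) / (1 + Real.tanh s * Real.tanh t) := by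
  have hs := (Real.cosh_pos s).ne'
  have ht := (Real.cosh_pos t).ne'
  have hst := (Real.cosh_pos (s + t)).ne'
  rw [Real.cosh_add] at hst
  have h1 : 1 + Real.tanh s * Real.tanh t ≠ 0 := by
    have : 1 + Real.tanh s * Real.tanh t =
        (Real.cosh s * Real.cosh t + Real.sinh s * Real.sinh t) / (Real.cosh s * Real.cosh t) := by
      rw [Real.tanh_eq_sinh_div_cosh, Real.tanh_eq_sinh_div_cosh]
      field_simp
    rw [this]
    positivity
  rw [eq_div_iff h1, Real.tanh_eq_sinh_div_cosh, Real.tanh_eq_sinh_div_cosh,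
    Real.tanh_eq_sinh_div_cosh, Real.sinh_add, Real.cosh_add]
  field_simp
  exact mul_div_cancel_right₀ _ (by rwa [mul_comm (Real.cosh t)])

theorem tanh_strictMono : StrictMono Real.tanh := by
  intro s t h
  have hu : Real.tanh t ∈ Ioo (-1) 1 := ⟨Real.neg_one_lt_tanh t, Real.tanh_lt_one t⟩
  have hs : Real.tanh s ∈ Ioo (-1) 1 := ⟨Real.neg_one_lt_tanh s, Real.tanh_lt_one s⟩
  rw [← Real.artanh_lt_artanh_iff hs hu, Real.artanh_tanh, Real.artanh_tanh]
  exact h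

theorem unitDisc_moebius {u : ℝ} (hu : |u| < 1) {ζ : ℂ} (hζ : ζ ∈ ball (0 : ℂ) 1) :
    1 + u * ζ ≠ 0 ∧ (ζ + u) / (1 + u * ζ) ∈ ball (0 : ℂ) 1 := by
  rw [mem_ball_zero_iff] at hζ
  have hne : 1 + u * ζ ≠ 0 := by
    intro h
    have h1 : (u : ℂ) * ζ = -1 := by linear_combination h
    have h2 : ‖(u : ℂ) * ζ‖ = 1 := by rw [h1]; simp
    rw [norm_mul, Complex.norm_real, Real.norm_eq_abs] at h2
    nlinarith [abs_nonneg u, norm_nonneg ζ]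
  refine ⟨hne, ?_⟩
  rw [mem_ball_zero_iff, norm_div, div_lt_one (norm_pos_iff.2 hne)]
  apply lt_of_pow_lt_pow_left₀ 2 (norm_nonneg _)
  have h1 : ‖ζ‖ ^ 2 < 1 := by nlinarith [norm_nonneg ζ]
  have h2 : u ^ 2 < 1 := by rw [← sq_abs]; nlinarith [abs_nonneg u]
  rw [← Complex.normSq_eq_norm_sq, Complex.normSq_apply] at h1 ⊢
  rw [← Complex.normSq_eq_norm_sq, Complex.normSq_apply]
  simp only [Complex.add_re, Complex.add_im, Complex.mul_re, Complex.mul_im, Complex.ofReal_re,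
    Complex.ofReal_im, Complex.one_re, Complex.one_im]
  -- The identity behind this is `|1 + uζ|² - |ζ + u|² = (1 - |ζ|²)(1 - u²)`.
  nlinarith [mul_pos (sub_pos.2 h1) (sub_pos.2 h2)]

section

variable {n : ℕ} {Ω : Set (EuclideanSpace ℂ (Fin n))} {x y z : EuclideanSpace ℂ (Fin n)}

/-- The automorphism `ζ ↦ (ζ + u) / (1 + u ζ)` with `u = tanh s` sends `0` to `tanh s` and, by the
addition formula, `tanh (t - s)` to `tanh t`. Thus `tanh` parametrizes the real diameter by
hyperbolic length. -/
theorem isDiscStep_tanh {φ : ℂ → EuclideanSpace ℂ (Fin n)}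
    (hφ : DifferentiableOn ℂ φ (ball 0 1)) (hm : MapsTo φ (ball 0 1) Ω) {s t : ℝ} (hst : s ≤ t) :
    IsDiscStep Ω (φ (Real.tanh s : ℝ)) (φ (Real.tanh t : ℝ)) (t - s) := by
  have hu : |Real.tanh s| < 1 := abs_lt.2 ⟨Real.neg_one_lt_tanh s, Real.tanh_lt_one s⟩
  refine ⟨sub_nonneg.2 hst, fun ζ => φ ((ζ + (Real.tanh s : ℝ)) / (1 + (Real.tanh s : ℝ) * ζ)),
    ?_, ?_, ?_, ?_⟩
  · refine hφ.comp ?_ fun ζ hζ => (unitDisc_moebius hu hζ).2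
    intro ζ hζ
    refine DifferentiableAt.differentiableWithinAt ?_
    exact (differentiableAt_id.add_const _).div ((differentiableAt_id.const_mul _).const_add _)
      (unitDisc_moebius hu hζ).1
  · exact fun ζ hζ => hm (unitDisc_moebius hu hζ).2
  · simp
  · have h := tanh_add_formula s (t - s)
    rw [add_sub_cancel] at h
    rw [h]
    push_cast
    rw [add_comm (Complex.tanh (t - s))]

theorem IsDiscStep.symm {a : ℝ} (h : IsDiscStep Ω x y a) : IsDiscStep Ω y x a := by
  obtain ⟨ha, φ, hφ, hm, rfl, rfl⟩ := h
  have hb : MapsTo (fun ζ : ℂ => -ζ) (ball 0 1) (ball 0 1) := fun ζ hζ => by simpa using hζ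
  have h := isDiscStep_tanh (Ω := Ω) (φ := fun ζ => φ (-ζ)) (s := -a) (t := 0)
    (hφ.comp differentiable_id.neg.differentiableOn hb) (hm.comp hb) (by linarith)
  simpa using h

theorem IsDiscStep.mem_left {a : ℝ} (h : IsDiscStep Ω x y a) : x ∈ Ω := by
  obtain ⟨ha, φ, hφ, hm, rfl, rfl⟩ := h
  exact hm (by simp)

theorem IsDiscStep.mem_right {a : ℝ} (h : IsDiscStep Ω x y a) : y ∈ Ω := h.symm.mem_left

theorem IsDiscStep.mono {Ω' : Set (EuclideanSpace ℂ (Fin n))} {a : ℝ} (h : IsDiscStep Ω x y a)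
    (hs : Ω ⊆ Ω') : IsDiscStep Ω' x y a := by
  obtain ⟨ha, φ, hφ, hm, h0, h1⟩ := h
  exact ⟨ha, φ, hφ, hm.mono_right hs, h0, h1⟩

theorem isDiscStep_artanh {φ : ℂ → EuclideanSpace ℂ (Fin n)}
    (hφ : DifferentiableOn ℂ φ (ball 0 1)) (hm : MapsTo φ (ball 0 1) Ω) {α : ℂ}
    (hα : α ∈ ball (0 : ℂ) 1) : IsDiscStep Ω (φ 0) (φ α) (Real.artanh ‖α‖) := by
  have hα' : ‖α‖ < 1 := by simpa using hα
  refine ⟨Real.artanh_nonneg (norm_nonneg _), ?_⟩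
  obtain ⟨u, hu, huα⟩ : ∃ u : ℂ, ‖u‖ = 1 ∧ u * ‖α‖ = α := by
    by_cases h : α = 0
    · exact ⟨1, by simp, by simp [h]⟩
    · have : (‖α‖ : ℂ) ≠ 0 := by simpa using h
      exact ⟨α / ‖α‖, by simp [h], by field_simp⟩
  have hb : MapsTo (fun ζ : ℂ => u * ζ) (ball 0 1) (ball 0 1) := fun ζ hζ => by
    simpa [hu] using hζ
  refine ⟨fun ζ => φ (u * ζ), hφ.comp (differentiable_id.const_mul u).differentiableOn hb,
    hm.comp hb, by simp, ?_⟩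
  have h : Real.tanh (Real.artanh ‖α‖) = ‖α‖ :=
    Real.tanh_artanh ⟨by linarith [norm_nonneg α], hα'⟩
  simp only [h, huα]

theorem kobayashiEDist_le_lempertFunction (x y : Ω) :
    kobayashiEDist Ω x y ≤ lempertFunction Ω x y :=
  iSup₂_le fun _ h => h x y

/-- Maximality of the Kobayashi pseudodistance. It is applied to the pullback of the pseudodistance
of a larger domain, to the infimum over chains, and to a multiple of the Euclidean distance. -/
theorem le_kobayashiEDist (δ : PseudoMetric Ω ℝ≥0∞)
    (h : ∀ (x y : Ω) (a : ℝ), IsDiscStep Ω (x : EuclideanSpace ℂ (Fin n)) y a →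
      δ x y ≤ ENNReal.ofReal a) (x y : Ω) : δ x y ≤ kobayashiEDist Ω x y := by
  refine le_iSup₂_of_le (f := fun (δ : PseudoMetric Ω ℝ≥0∞)
    (_ : ∀ x y : Ω, δ x y ≤ lempertFunction Ω x y) => δ x y) δ ?_ le_rfl
  intro x y
  simp only [lempertFunction, le_iInf_iff]
  intro φ α hφ hm hα h0 h1
  refine h x y _ ?_
  rw [← h0, ← h1]
  exact isDiscStep_artanh hφ hm hα

theorem kobayashiEDist_self (x : Ω) : kobayashiEDist Ω x x = 0 := by
  simp [kobayashiEDist]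

theorem kobayashiEDist_comm (x y : Ω) : kobayashiEDist Ω x y = kobayashiEDist Ω y x := by
  simp only [kobayashiEDist]
  exact iSup_congr fun δ => iSup_congr fun _ => δ.symm x y

theorem kobayashiEDist_triangle (x y z : Ω) :
    kobayashiEDist Ω x z ≤ kobayashiEDist Ω x y + kobayashiEDist Ω y z := by
  refine iSup₂_le fun δ h => (δ.triangle x y z).trans (add_le_add ?_ ?_)
  · exact le_iSup₂_of_le (f := fun (δ : PseudoMetric Ω ℝ≥0∞)
      (_ : ∀ x y : Ω, δ x y ≤ lempertFunction Ω x y) => δ x y) δ h le_rfl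
  · exact le_iSup₂_of_le (f := fun (δ : PseudoMetric Ω ℝ≥0∞)
      (_ : ∀ x y : Ω, δ x y ≤ lempertFunction Ω x y) => δ y z) δ h le_rfl

theorem IsDiscStep.kobayashiLE {a : ℝ} (h : IsDiscStep Ω x y a) : KobayashiLE Ω x y a := by
  refine ⟨h.mem_left, h.mem_right, (kobayashiEDist_le_lempertFunction _ _).trans ?_⟩
  obtain ⟨ha, φ, hφ, hm, h0, h1⟩ := h
  unfold lempertFunction
  refine iInf_le_of_le φ (iInf_le_of_le (Real.tanh a : ℝ) (iInf_le_of_le hφ (iInf_le_of_le hm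
    (iInf_le_of_le (tanh_mem_unitBall a) (iInf_le_of_le h0 (iInf_le_of_le h1 ?_))))))
  rw [Complex.norm_real, Real.norm_eq_abs, abs_of_nonneg, Real.artanh_tanh]
  rw [← Real.tanh_zero]
  exact tanh_strictMono.monotone ha

theorem KobayashiLE.refl (hx : x ∈ Ω) : KobayashiLE Ω x x 0 :=
  ⟨hx, hx, by simp [kobayashiEDist_self]⟩

theorem KobayashiLE.symm {T : ℝ} (h : KobayashiLE Ω x y T) : KobayashiLE Ω y x T := by
  obtain ⟨hx, hy, h⟩ := h
  exact ⟨hy, hx, by rwa [kobayashiEDist_comm]⟩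

theorem KobayashiLE.mono {S T : ℝ} (h : KobayashiLE Ω x y S) (hST : S ≤ T) :
    KobayashiLE Ω x y T := by
  obtain ⟨hx, hy, h⟩ := h
  exact ⟨hx, hy, h.trans (ENNReal.ofReal_le_ofReal hST)⟩

theorem KobayashiLE.trans {S T : ℝ} (h : KobayashiLE Ω x y S) (h' : KobayashiLE Ω y z T)
    (hS : 0 ≤ S) (hT : 0 ≤ T) : KobayashiLE Ω x z (S + T) := by
  obtain ⟨hx, hy, h⟩ := h
  obtain ⟨_, hz, h'⟩ := h'
  refine ⟨hx, hz, (kobayashiEDist_triangle _ ⟨y, hy⟩ _).trans ?_⟩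
  rw [ENNReal.ofReal_add hS hT]
  exact add_le_add h h'

theorem kobayashiEDist_mono {Ω' : Set (EuclideanSpace ℂ (Fin n))} (hs : Ω ⊆ Ω') (x y : Ω) :
    kobayashiEDist Ω' (inclusion hs x) (inclusion hs y) ≤ kobayashiEDist Ω x y := by
  let δ : PseudoMetric Ω ℝ≥0∞ :=
    { toFun := fun x y => kobayashiEDist Ω' (inclusion hs x) (inclusion hs y)
      refl' := fun _ => kobayashiEDist_self _
      symm' := fun _ _ => kobayashiEDist_comm _ _
      triangle' := fun _ _ _ => kobayashiEDist_triangle _ _ _ }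
  refine le_kobayashiEDist δ (fun x y a h => ?_) x y
  obtain ⟨_, _, h⟩ := (h.mono hs).kobayashiLE
  exact h

/-! ### Chains of discs -/

variable {ε : ℝ}

theorem DiscChain.nonneg {T : ℝ} (h : DiscChain Ω ε x y T) : 0 ≤ T := by
  induction h with
  | nil => exact le_rfl
  | snoc _ hs _ ih => exact add_nonneg ih hs.1

theorem DiscChain.trans {S T : ℝ} (h : DiscChain Ω ε x y S) (h' : DiscChain Ω ε y z T) :
    DiscChain Ω ε x z (S + T) := by
  induction h' with
  | nil => simpa using h
  | snoc _ hs ha ih => rw [← add_assoc]; exact ih.snoc hs ha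

theorem IsDiscStep.discChain {a : ℝ} (h : IsDiscStep Ω x y a) (ha : a ≤ ε) :
    DiscChain Ω ε x y a := by
  simpa using (DiscChain.nil h.mem_left).snoc h ha

theorem DiscChain.symm {T : ℝ} (h : DiscChain Ω ε x y T) : DiscChain Ω ε y x T := by
  induction h with
  | nil hx => exact .nil hx
  | snoc _ hs ha ih => rw [add_comm]; exact (hs.symm.discChain ha).trans ih

theorem IsDiscStep.exists_subdivision {a : ℝ} (h : IsDiscStep Ω x y a) (hε : 0 < ε) :
    DiscChain Ω ε x y a := by
  obtain ⟨ha, φ, hφ, hm, rfl, rfl⟩ := h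
  -- The diameter segment is cut into `N` pieces of equal hyperbolic length `a / N ≤ ε`; the case `N
  -- = 0` forces `a = 0`.
  obtain ⟨N, hN⟩ := exists_nat_ge (a / ε)
  rcases Nat.eq_zero_or_pos N with rfl | hNpos
  · have : a = 0 := by
      have : a / ε ≤ 0 := by simpa using hN
      exact le_antisymm (by simpa using (div_le_iff₀ hε).1 this) ha
    subst this
    simpa using DiscChain.nil (ε := ε) (hm (x := 0) (by simp))
  have hN' : (0 : ℝ) < N := by exact_mod_cast hNpos
  have key : ∀ k : ℕ, DiscChain Ω ε (φ 0) (φ (Real.tanh (k * (a / N)) : ℝ)) (k * (a / N)) := by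
    intro k
    induction k with
    | zero => simpa using DiscChain.nil (ε := ε) (hm (x := 0) (by simp))
    | succ k ih =>
      have hst : (k : ℝ) * (a / N) ≤ ((k + 1 : ℕ) : ℝ) * (a / N) := by
        gcongr
        omega
      have hs := isDiscStep_tanh hφ hm hst
      have h1 : ((k + 1 : ℕ) : ℝ) * (a / N) - k * (a / N) = a / N := by push_cast; ring
      have h2 := ih.snoc hs (by
        rw [h1, div_le_iff₀ hN', mul_comm]
        exact (div_le_iff₀ hε).1 hN)
      simpa using h2
  have := key N
  rwa [mul_div_cancel₀ _ hN'.ne'] at this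

/-- The infimum of the lengths of chains is itself a pseudodistance. Subdividing a disc step costs
nothing, so this infimum stays below the Lempert function whatever the bound `ε` on the steps. -/
theorem exists_discChain_of_kobayashiEDist_lt (hε : 0 < ε) {x y : Ω} {c : ℝ≥0∞}
    (h : kobayashiEDist Ω x y < c) :
    ∃ T : ℝ, DiscChain Ω ε (x : EuclideanSpace ℂ (Fin n)) y T ∧ ENNReal.ofReal T < c := by
  let δ : PseudoMetric Ω ℝ≥0∞ :=
    { toFun := fun x y => ⨅ (T : ℝ) (_ : DiscChain Ω ε (x : EuclideanSpace ℂ (Fin n)) y T),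
        ENNReal.ofReal T
      refl' := fun x => le_antisymm (iInf₂_le_of_le 0 (.nil x.2) (by simp)) zero_le
      symm' := fun x y => iInf_congr fun T =>
        iInf_congr_Prop ⟨DiscChain.symm, DiscChain.symm⟩ fun _ => rfl
      triangle' := fun x y z => by
        refine ENNReal.le_of_forall_pos_le_add fun η hη hfin => ?_
        simp only [ENNReal.iInf_add, ENNReal.add_iInf, le_iInf_iff]
        intro T hT S hS
        rw [← ENNReal.ofReal_add hS.nonneg hT.nonneg]
        exact le_add_right (iInf₂_le_of_le _ (hS.trans hT) le_rfl) }
  have h1 : δ x y ≤ kobayashiEDist Ω x y := le_kobayashiEDist δ (fun x y a hs =>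
    iInf₂_le_of_le a (hs.exists_subdivision hε) le_rfl) x y
  have h2 := h1.trans_lt h
  obtain ⟨T, hT⟩ := iInf_lt_iff.1 h2
  obtain ⟨hc, hT⟩ := iInf_lt_iff.1 hT
  exact ⟨T, hc, hT⟩

/-- A chain of discs as a sequence of points `p` with partial sums `S`. -/
theorem DiscChain.exists_seq {T : ℝ} (h : DiscChain Ω ε x y T) :
    ∃ (N : ℕ) (p : ℕ → EuclideanSpace ℂ (Fin n)) (S : ℕ → ℝ), p 0 = x ∧ p N = y ∧ S 0 = 0 ∧
      S N = T ∧ (∀ i ≤ N, p i ∈ Ω) ∧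
      ∀ i < N, IsDiscStep Ω (p i) (p (i + 1)) (S (i + 1) - S i) ∧ S (i + 1) - S i ≤ ε := by
  induction h with
  | nil hx => exact ⟨0, fun _ => x, fun _ => 0, rfl, rfl, rfl, rfl, fun _ _ => hx, by simp⟩
  | @snoc y z T a _ hs ha ih =>
    obtain ⟨N, p, S, h0, hN, hS0, hSN, hm, hst⟩ := ih
    refine ⟨N + 1, fun i => if i ≤ N then p i else z, fun i => if i ≤ N then S i else T + a,
      by simpa, by simp, by simpa, by simp, fun i _ => ?_, fun i hi => ?_⟩
    · dsimp only
      split_ifs with h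
      · exact hm i h
      · exact hs.mem_right
    · have hi' : i ≤ N := by omega
      by_cases h : i + 1 ≤ N
      · simpa [h, hi'] using hst i (by omega)
      · have : i = N := by omega
        subst this
        simp [hN, hSN, hs, ha]

end

/-! ### The Kobayashi distance of bounded domains -/

theorem self_le_artanh {s : ℝ} (h0 : 0 ≤ s) (h1 : s < 1) : s ≤ Real.artanh s := by
  have h := Real.sum_range_le_log_div h0 h1 1
  rw [Real.artanh_eq_half_log ⟨by linarith, h1.le⟩]
  simpa using h

theorem tanh_nonneg_of_nonneg {a : ℝ} (h : 0 ≤ a) : 0 ≤ Real.tanh a := by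
  rw [← Real.tanh_zero]
  exact tanh_strictMono.monotone h

theorem tanh_le_self {a : ℝ} (h : 0 ≤ a) : Real.tanh a ≤ a := by
  have := self_le_artanh (tanh_nonneg_of_nonneg h) (Real.tanh_lt_one a)
  rwa [Real.artanh_tanh] at this

theorem artanh_le_two_mul {s : ℝ} (h0 : 0 ≤ s) (h1 : s ≤ 1 / 2) : Real.artanh s ≤ 2 * s := by
  rw [Real.artanh_eq_half_log ⟨by linarith, by linarith⟩]
  have hs : 0 < 1 - s := by linarith
  have h := Real.log_le_sub_one_of_pos (x := (1 + s) / (1 - s)) (by positivity)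
  have h2 : (1 + s) / (1 - s) - 1 ≤ 4 * s := by
    rw [sub_le_iff_le_add, div_le_iff₀ hs]
    nlinarith
  linarith

section

variable {n : ℕ} {Ω : Set (EuclideanSpace ℂ (Fin n))} {x y z : EuclideanSpace ℂ (Fin n)}

theorem isDiscStep_of_mem_ball {ρ : ℝ} (hb : ball x ρ ⊆ Ω) (hy : y ∈ ball x ρ) :
    IsDiscStep Ω x y (Real.artanh (dist y x / ρ)) := by
  have hρ : 0 < ρ := pos_of_mem_ball hy
  rw [mem_ball] at hy
  have hα : dist y x / ρ < 1 := (div_lt_one hρ).2 hy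
  have hα0 : 0 ≤ dist y x / ρ := by positivity
  refine ⟨Real.artanh_nonneg hα0,
    fun ζ => x + ζ • (((ρ / dist y x : ℝ) : ℂ) • (y - x)), ?_, ?_, by simp, ?_⟩
  · exact ((differentiable_id.smul_const _).const_add _).differentiableOn
  · intro ζ hζ
    apply hb
    rw [mem_ball_zero_iff] at hζ
    rw [mem_ball, dist_eq_norm, add_sub_cancel_left, norm_smul, norm_smul, Complex.norm_real,
      ← dist_eq_norm, Real.norm_eq_abs, abs_of_nonneg (by positivity)]
    have : ρ / dist y x * dist y x ≤ ρ := by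
      rcases eq_or_ne (dist y x) 0 with h | h
      · simpa [h] using hρ.le
      · rw [div_mul_cancel₀ _ h]
    nlinarith [norm_nonneg ζ]
  · dsimp only
    rw [Real.tanh_artanh ⟨by linarith, hα⟩, smul_smul, ← Complex.ofReal_mul]
    rcases eq_or_ne y x with rfl | hne
    · simp
    · have h1 : dist y x ≠ 0 := dist_ne_zero.2 hne
      rw [div_mul_div_comm, mul_comm ρ, div_self (mul_ne_zero h1 hρ.ne')]
      simp

theorem kobayashiLE_artanh_half {ρ : ℝ} (hb : ball x ρ ⊆ Ω) (hρ : 0 < ρ)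
    (hy : dist y x ≤ ρ / 2) : KobayashiLE Ω x y (Real.artanh (1 / 2)) := by
  refine (isDiscStep_of_mem_ball hb (mem_ball.2 (by linarith))).kobayashiLE.mono ?_
  refine Real.artanh_le_artanh ?_ (by norm_num) ?_
  · have : 0 ≤ dist y x / ρ := by positivity
    linarith
  · rw [div_le_iff₀ hρ]
    linarith

theorem exists_kobayashiLE (ho : IsOpen Ω) (hc : IsPreconnected Ω) (hx : x ∈ Ω) (hy : y ∈ Ω) :
    ∃ T, 0 ≤ T ∧ KobayashiLE Ω x y T := by
  refine hc.induction₂ (fun x y => ∃ T, 0 ≤ T ∧ KobayashiLE Ω x y T) ?_ ?_ ?_ hx hy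
  · intro x hx
    obtain ⟨ρ, hρ, hb⟩ := Metric.isOpen_iff.1 ho x hx
    refine mem_nhdsWithin_of_mem_nhds ?_
    filter_upwards [ball_mem_nhds x (half_pos hρ)] with y hy
    exact ⟨_, Real.artanh_nonneg (by norm_num), kobayashiLE_artanh_half hb hρ (mem_ball.1 hy).le⟩
  · rintro x y z _ _ _ ⟨T, hT, h⟩ ⟨S, hS, h'⟩
    exact ⟨_, add_nonneg hT hS, h.trans h' hT hS⟩
  · rintro x y _ _ ⟨T, hT, h⟩
    exact ⟨T, hT, h.symm⟩

theorem exists_kobayashiLE_of_isCompact (ho : IsOpen Ω) (hc : IsPreconnected Ω) (hx : x ∈ Ω)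
    {Q : Set (EuclideanSpace ℂ (Fin n))} (hQ : IsCompact Q) (hQΩ : Q ⊆ Ω) :
    ∃ R, 0 ≤ R ∧ ∀ q ∈ Q, KobayashiLE Ω x q R := by
  refine hQ.induction_on (p := fun Q => ∃ R, 0 ≤ R ∧ ∀ q ∈ Q, KobayashiLE Ω x q R)
    ⟨0, le_rfl, by simp⟩ ?_ ?_ ?_
  · rintro s t hst ⟨R, hR, h⟩
    exact ⟨R, hR, fun q hq => h q (hst hq)⟩
  · rintro s t ⟨R, hR, h⟩ ⟨R', hR', h'⟩
    refine ⟨max R R', le_max_of_le_left hR, fun q hq => hq.elim (fun hq => ?_) fun hq => ?_⟩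
    · exact (h q hq).mono (le_max_left _ _)
    · exact (h' q hq).mono (le_max_right _ _)
  · intro q hq
    obtain ⟨ρ, hρ, hb⟩ := Metric.isOpen_iff.1 ho q (hQΩ hq)
    obtain ⟨T, hT, h⟩ := exists_kobayashiLE ho hc hx (hQΩ hq)
    have ha : 0 ≤ Real.artanh (1 / 2) := Real.artanh_nonneg (by norm_num)
    refine ⟨ball q (ρ / 2), mem_nhdsWithin_of_mem_nhds (ball_mem_nhds _ (half_pos hρ)),
      T + Real.artanh (1 / 2), add_nonneg hT ha, fun y hy => ?_⟩
    exact h.trans (kobayashiLE_artanh_half hb hρ (mem_ball.1 hy).le) hT ha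

/-- By the Schwarz lemma, a disc in a set of diameter at most `R` moves its centre by at most `R *
tanh a ≤ R * a`. -/
theorem exists_mul_dist_le_of_kobayashiLE (hb : Bornology.IsBounded Ω) :
    ∃ c > 0, ∀ x y T, KobayashiLE Ω x y T → 0 ≤ T → c * dist x y ≤ T := by
  obtain ⟨R, hR, hRb⟩ : ∃ R > 0, ∀ x ∈ Ω, ∀ y ∈ Ω, dist x y ≤ R := by
    obtain ⟨R, hR⟩ := isBounded_iff.1 hb
    exact ⟨max R 1, by positivity, fun x hx y hy => le_max_of_le_left (hR hx hy)⟩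
  refine ⟨R⁻¹, inv_pos.2 hR, ?_⟩
  rintro x y T ⟨hx, hy, h⟩ hT
  let δ : PseudoMetric Ω ℝ≥0∞ :=
    { toFun := fun x y => ENNReal.ofReal (R⁻¹ * dist x y)
      refl' := fun _ => by simp
      symm' := fun x y => by rw [dist_comm]
      triangle' := fun x y z => by
        rw [← ENNReal.ofReal_add (by positivity) (by positivity), ← mul_add]
        exact ENNReal.ofReal_le_ofReal (by gcongr; exact dist_triangle _ _ _) }
  have key : δ ⟨x, hx⟩ ⟨y, hy⟩ ≤ kobayashiEDist Ω ⟨x, hx⟩ ⟨y, hy⟩ := by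
    refine le_kobayashiEDist δ ?_ _ _
    rintro ⟨x, hx⟩ ⟨y, hy⟩ a ⟨ha, φ, hφ, hm, h0, h1⟩
    refine ENNReal.ofReal_le_ofReal ?_
    have hs := Complex.dist_le_div_mul_dist_of_mapsTo_ball (R₂ := R) hφ
      (fun ζ hζ => mem_closedBall.2 (hRb _ (hm hζ) _ (hm (by simp)))) (tanh_mem_unitBall a)
    rw [h0, h1, dist_zero_right, Complex.norm_real, Real.norm_eq_abs,
      abs_of_nonneg (tanh_nonneg_of_nonneg ha), div_one] at hs
    rw [Subtype.dist_eq, dist_comm, inv_mul_le_iff₀ hR]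
    exact hs.trans (by gcongr; exact tanh_le_self ha)
  exact (ENNReal.ofReal_le_ofReal_iff hT).1 (key.trans h)

theorem kobayashiEDist_ne_top (ho : IsOpen Ω) (hc : IsPreconnected Ω) (x y : Ω) :
    kobayashiEDist Ω x y ≠ ⊤ := by
  obtain ⟨T, _, _, _, h⟩ := exists_kobayashiLE ho hc x.2 y.2
  exact ne_top_of_le_ne_top ENNReal.ofReal_ne_top h

theorem KobayashiLE.kobayashiDist_le {x y : Ω} {T : ℝ} (hT : 0 ≤ T)
    (h : KobayashiLE Ω (x : EuclideanSpace ℂ (Fin n)) y T) : kobayashiDist Ω x y ≤ T := by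
  obtain ⟨_, _, h⟩ := h
  exact ENNReal.toReal_le_of_le_ofReal hT h

theorem kobayashiLE_kobayashiDist (ho : IsOpen Ω) (hc : IsPreconnected Ω) (x y : Ω) :
    KobayashiLE Ω (x : EuclideanSpace ℂ (Fin n)) y (kobayashiDist Ω x y) := by
  refine ⟨x.2, y.2, ?_⟩
  rw [kobayashiDist, ENNReal.ofReal_toReal (kobayashiEDist_ne_top ho hc x y)]

theorem kobayashiDist_nonneg (x y : Ω) : 0 ≤ kobayashiDist Ω x y := ENNReal.toReal_nonneg

theorem isDistance_kobayashiDist (ho : IsOpen Ω) (hc : IsPreconnected Ω)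
    (hb : Bornology.IsBounded Ω) : IsDistance (kobayashiDist Ω) where
  self_eq_zero x := by simp [kobayashiDist, kobayashiEDist_self]
  pos x y hxy := by
    obtain ⟨c, hc0, h⟩ := exists_mul_dist_le_of_kobayashiLE hb
    have h1 := h _ _ _ (kobayashiLE_kobayashiDist ho hc x y) (kobayashiDist_nonneg x y)
    have : 0 < dist (x : EuclideanSpace ℂ (Fin n)) y := dist_pos.2 (Subtype.coe_injective.ne hxy)
    exact lt_of_lt_of_le (by positivity) h1
  symm x y := by rw [kobayashiDist, kobayashiEDist_comm, kobayashiDist]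
  triangle x y z := ((kobayashiLE_kobayashiDist ho hc x y).trans
    (kobayashiLE_kobayashiDist ho hc y z) (kobayashiDist_nonneg _ _)
    (kobayashiDist_nonneg _ _)).kobayashiDist_le
      (add_nonneg (kobayashiDist_nonneg _ _) (kobayashiDist_nonneg _ _))

end

/-! ### Analytic discs at boundary points with a positive Levi eigenvalue -/

/-- The expansion is uniform in the base point `z`, with the Hessian frozen at `p`. Strict
differentiability of the gradient at `p` controls the derivative of the remainder along the segment
from `z` to `z + h`. -/
theorem ContDiffAt.exists_second_order_estimate {V : Type*} [NormedAddCommGroup V]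
    [NormedSpace ℝ V] {f : V → ℝ} {p : V} (hf : ContDiffAt ℝ 2 f p) {η : ℝ} (hη : 0 < η) :
    ∃ ρ > 0, ∀ z h : V, z ∈ ball p ρ → z + h ∈ ball p ρ →
      |f (z + h) - f z - fderiv ℝ f z h - fderiv ℝ (fderiv ℝ f) p h h / 2| ≤ η * ‖h‖ ^ 2 := by
  have hs : HasStrictFDerivAt (fderiv ℝ f) (fderiv ℝ (fderiv ℝ f) p) p :=
    (hf.fderiv_right (m := 1) (by norm_num)).hasStrictFDerivAt one_ne_zero
  have h1 := hs.isLittleO.def hη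
  have h2 : ∀ᶠ z in 𝓝 p, DifferentiableAt ℝ f z :=
    (hf.eventually (by simp)).mono fun z hz => hz.differentiableAt two_ne_zero
  obtain ⟨ρ₁, hρ₁, h1⟩ := Metric.eventually_nhds_iff_ball.1 h1
  obtain ⟨ρ₂, hρ₂, h2⟩ := Metric.eventually_nhds_iff_ball.1 h2
  refine ⟨min ρ₁ ρ₂, lt_min hρ₁ hρ₂, fun z h hz hzh => ?_⟩
  set B := fderiv ℝ (fderiv ℝ f) p
  have hseg : ∀ τ ∈ Icc (0 : ℝ) 1, z + τ • h ∈ ball p (min ρ₁ ρ₂) := fun τ hτ =>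
    (convex_ball _ _).add_smul_mem hz hzh hτ
  have hd : ∀ τ ∈ Icc (0 : ℝ) 1, HasDerivWithinAt
      (fun τ : ℝ => f (z + τ • h) - τ * fderiv ℝ f z h - τ ^ 2 * (B h h / 2))
      (fderiv ℝ f (z + τ • h) h - fderiv ℝ f z h - τ * B h h) (Icc 0 1) τ := by
    intro τ hτ
    have hτ' := ball_subset_ball (min_le_right ρ₁ ρ₂) (hseg τ hτ)
    have e1 : HasDerivAt (fun τ : ℝ => z + τ • h) h τ := by
      simpa using ((hasDerivAt_id τ).smul_const h).const_add z
    have e2 := (h2 _ hτ').hasFDerivAt.comp_hasDerivAt τ e1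
    have e3 : HasDerivAt (fun τ : ℝ => τ * fderiv ℝ f z h) (fderiv ℝ f z h) τ := by
      simpa using (hasDerivAt_id τ).mul_const (fderiv ℝ f z h)
    have e4 : HasDerivAt (fun τ : ℝ => τ ^ 2 * (B h h / 2)) (τ * B h h) τ := by
      refine ((hasDerivAt_pow 2 τ).mul_const (B h h / 2)).congr_deriv ?_
      norm_num
      ring
    exact ((e2.sub e3).sub e4).hasDerivWithinAt
  have hbound : ∀ τ ∈ Ico (0 : ℝ) 1,
      ‖fderiv ℝ f (z + τ • h) h - fderiv ℝ f z h - τ * B h h‖ ≤ η * ‖h‖ ^ 2 := by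
    intro τ hτ
    have hτ' := ball_subset_ball (min_le_left ρ₁ ρ₂) (hseg τ (Ico_subset_Icc_self hτ))
    have hz' := ball_subset_ball (min_le_left ρ₁ ρ₂) hz
    have e := h1 (z + τ • h, z) (by rw [← ball_prod_same]; exact ⟨hτ', hz'⟩)
    simp only [add_sub_cancel_left] at e
    have e2 := (fderiv ℝ f (z + τ • h) - fderiv ℝ f z - B (τ • h)).le_of_opNorm_le e h
    have e3 : (fderiv ℝ f (z + τ • h) - fderiv ℝ f z - B (τ • h)) h =
        fderiv ℝ f (z + τ • h) h - fderiv ℝ f z h - τ * B h h := by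
      simp
    rw [e3] at e2
    refine e2.trans ?_
    rw [norm_smul, Real.norm_eq_abs, abs_of_nonneg hτ.1]
    nlinarith [mul_nonneg hη.le (sq_nonneg ‖h‖), hτ.2]
  have := norm_image_sub_le_of_norm_deriv_le_segment_01' hd hbound
  simp only [one_smul, zero_smul, add_zero, Real.norm_eq_abs] at this
  refine le_trans (le_of_eq ?_) this
  congr 1
  ring

theorem quadratic_perturbation {V : Type*} [NormedAddCommGroup V] [NormedSpace ℂ V]
    [NormedSpace ℝ V] (B : V →L[ℝ] V →L[ℝ] ℝ)
    {X W : V} {σ : ℝ} (hσ : σ ≤ 1) (hW : ‖W - X‖ ≤ σ) (t : ℂ) :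
    B (t • X) (t • X) - ‖B‖ * (2 * ‖X‖ + 1) * σ * ‖t‖ ^ 2 ≤ B (t • W) (t • W) := by
  have hσ0 : 0 ≤ σ := (norm_nonneg _).trans hW
  have hWn : ‖W‖ ≤ ‖X‖ + 1 := by
    have := norm_add_le X (W - X)
    rw [add_sub_cancel] at this
    linarith
  have h1 : B (t • W) (t • W) - B (t • X) (t • X) =
      B (t • W) (t • (W - X)) + B (t • (W - X)) (t • X) := by
    simp only [smul_sub, map_sub, sub_apply]
    ring
  have h2 : ‖B (t • W) (t • (W - X))‖ ≤ ‖B‖ * (‖t‖ * (‖X‖ + 1)) * (‖t‖ * σ) := by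
    refine (B.le_opNorm₂ _ _).trans ?_
    rw [norm_smul, norm_smul]
    gcongr
  have h3 : ‖B (t • (W - X)) (t • X)‖ ≤ ‖B‖ * (‖t‖ * σ) * (‖t‖ * ‖X‖) := by
    refine (B.le_opNorm₂ _ _).trans ?_
    rw [norm_smul, norm_smul]
    gcongr
  have h4 := neg_le_of_abs_le h2
  have h5 := neg_le_of_abs_le h3
  have h6 : ‖B‖ * (‖t‖ * (‖X‖ + 1)) * (‖t‖ * σ) + ‖B‖ * (‖t‖ * σ) * (‖t‖ * ‖X‖) =
      ‖B‖ * (2 * ‖X‖ + 1) * σ * ‖t‖ ^ 2 := by ring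
  linarith

theorem exists_pos_mul_le {a b : ℝ} (ha : 0 ≤ a) (hb : 0 < b) : ∃ s > 0, s ≤ 1 ∧ s * a ≤ b := by
  refine ⟨min 1 (b / (a + 1)), by positivity, min_le_left _ _, ?_⟩
  calc min 1 (b / (a + 1)) * a ≤ b / (a + 1) * (a + 1) := by
        gcongr
        · exact min_le_right _ _
        · linarith
    _ = b := by field_simp

section

variable {V : Type*} [NormedAddCommGroup V] [NormedSpace ℂ V] [NormedSpace ℝ V]
  [IsScalarTower ℝ ℂ V]

theorem complex_smul_eq (t : ℂ) (v : V) :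
    t • v = t.re • v + t.im • (Complex.I • v) := by
  conv_lhs => rw [← Complex.re_add_im t]
  rw [add_smul, mul_smul, ← Complex.coe_algebraMap, algebraMap_smul, algebraMap_smul]

theorem map_complex_combination (L : V →L[ℝ] ℝ) (a b : ℝ)
    (v : V) :
    L (a • v + b • (Complex.I • v)) = a * L v + b * L (Complex.I • v) ∧
      L (Complex.I • (a • v + b • (Complex.I • v))) = a * L (Complex.I • v) - b * L v := by
  constructor
  · simp
  · have : Complex.I • (a • v + b • (Complex.I • v)) = a • (Complex.I • v) - b • v := by
      rw [smul_add, smul_comm Complex.I a, smul_comm Complex.I b, smul_smul Complex.I,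
        Complex.I_mul_I, neg_one_smul, smul_neg, sub_eq_add_neg]
    rw [this, map_sub, L.map_smul, L.map_smul, smul_eq_mul, smul_eq_mul]

theorem exists_apply_eq_one_and_apply_I_smul_eq_zero {L : V →L[ℝ] ℝ}
    (hL : L ≠ 0) : ∃ N, L N = 1 ∧ L (Complex.I • N) = 0 := by
  obtain ⟨v, hv⟩ := ContinuousLinearMap.exists_ne_zero hL
  have hab : L v ^ 2 + L (Complex.I • v) ^ 2 ≠ 0 := by positivity
  -- With `ℓ v = L v - i L (i v)`, the complex-linear functional attached to `L`, these coefficients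
  -- are the real and imaginary parts of `1 / ℓ v`.
  obtain ⟨h1, h2⟩ := map_complex_combination L (L v / (L v ^ 2 + L (Complex.I • v) ^ 2))
    (L (Complex.I • v) / (L v ^ 2 + L (Complex.I • v) ^ 2)) v
  refine ⟨_, h1.trans ?_, h2.trans ?_⟩
  · field_simp
  · ring

/-- A vector annihilated by the complex-linear part of `L p` extends to a field of vectors
annihilated by the complex-linear parts of `L z`, for `z` near `p`. -/
theorem exists_complexTangent_field
    {L : V → V →L[ℝ] ℝ}
    {p X : V} (hL : ContinuousAt L p) (hp : L p ≠ 0) (hX1 : L p X = 0)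
    (hX2 : L p (Complex.I • X) = 0) :
    ∃ Y : V → V, Tendsto Y (𝓝 p) (𝓝 X) ∧
      ∀ᶠ z in 𝓝 p, ∀ t : ℂ, L z (t • Y z) = 0 := by
  obtain ⟨N, hN1, hN2⟩ := exists_apply_eq_one_and_apply_I_smul_eq_zero hp
  have hP : ∀ v, Tendsto (fun z => L z v) (𝓝 p) (𝓝 (L p v)) := fun v =>
    hL.clm_apply continuousAt_const
  -- With `ℓ v = L z v - i L z (i v)`, one has `α + iβ = ℓ X / ℓ N`, so subtracting `(α + iβ) N`
  -- from `X` projects it along `N` to the kernel of `ℓ`. Here `d = |ℓ N|²`.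
  let d : V → ℝ := fun z => L z N ^ 2 + L z (Complex.I • N) ^ 2
  let α : V → ℝ := fun z =>
    (L z X * L z N + L z (Complex.I • X) * L z (Complex.I • N)) / d z
  let β : V → ℝ := fun z =>
    (L z X * L z (Complex.I • N) - L z (Complex.I • X) * L z N) / d z
  have hd : Tendsto d (𝓝 p) (𝓝 1) := by
    have := ((hP N).pow 2).add ((hP (Complex.I • N)).pow 2)
    simpa [hN1, hN2] using this
  have hα : Tendsto α (𝓝 p) (𝓝 0) := by
    have := (((hP X).mul (hP N)).add ((hP (Complex.I • X)).mul (hP (Complex.I • N)))).div hd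
      one_ne_zero
    rw [hX1, hX2] at this
    simp only [zero_mul, add_zero, zero_div] at this
    exact this
  have hβ : Tendsto β (𝓝 p) (𝓝 0) := by
    have := (((hP X).mul (hP (Complex.I • N))).sub ((hP (Complex.I • X)).mul (hP N))).div hd
      one_ne_zero
    rw [hX1, hX2] at this
    simp only [zero_mul, sub_zero, zero_div] at this
    exact this
  refine ⟨fun z => X - (α z • N + β z • (Complex.I • N)), ?_, ?_⟩
  · have := (tendsto_const_nhds (x := X)).sub
      ((hα.smul_const N).add (hβ.smul_const (Complex.I • N)))
    simpa using this
  · filter_upwards [hd.eventually_ne one_ne_zero] with z hz t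
    obtain ⟨e1, e2⟩ := map_complex_combination (L z) (α z) (β z) N
    have h1 : L z X = α z * L z N + β z * L z (Complex.I • N) := by
      simp only [α, β]
      field_simp
      simp only [d]
      ring
    have h2 : L z (Complex.I • X) = α z * L z (Complex.I • N) - β z * L z N := by
      simp only [α, β]
      field_simp
      simp only [d]
      ring
    rw [complex_smul_eq, map_add, map_smul, map_smul, smul_sub Complex.I, map_sub, map_sub, e1,
      e2, h1, h2]
    simp

/-- The pluriharmonic part of a real quadratic form is compensated by a curve `t² • c`. -/
theorem exists_quadratic_correction {L : V →L[ℝ] ℝ} (hL : L ≠ 0)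
    (B : V →L[ℝ] V →L[ℝ] ℝ)
    (X : V) {lam : ℝ}
    (hlam : B X X + B (Complex.I • X) (Complex.I • X) = 4 * lam) :
    ∃ c, ∀ t : ℂ, L (t ^ 2 • c) + B (t • X) (t • X) / 2 = lam * ‖t‖ ^ 2 := by
  obtain ⟨N, hN1, hN2⟩ := exists_apply_eq_one_and_apply_I_smul_eq_zero hL
  obtain ⟨e1, e2⟩ := map_complex_combination L
    (-(B X X - B (Complex.I • X) (Complex.I • X)) / 4)
    ((B X (Complex.I • X) + B (Complex.I • X) X) / 4) N
  -- In `B (tX) (tX) / 2` the coefficient of `Re t²` is `(B X X - B (iX) (iX)) / 4`, that of `Im t²`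
  -- is `(B X (iX) + B (iX) X) / 4`, and the rest is `lam * ‖t‖²`. Since `L (t² c) = Re t² * L c +
  -- Im t² * L (i c)`, this `c` cancels both harmonic terms.
  refine ⟨(-(B X X - B (Complex.I • X) (Complex.I • X)) / 4) • N +
    ((B X (Complex.I • X) + B (Complex.I • X) X) / 4) • (Complex.I • N), fun t => ?_⟩
  · have hB : B (t • X) (t • X) = t.re * (t.re * B X X + t.im * B X (Complex.I • X)) +
        t.im * (t.re * B (Complex.I • X) X + t.im * B (Complex.I • X) (Complex.I • X)) := by
      rw [complex_smul_eq t X]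
      simp only [map_add, map_smul, add_apply, smul_apply, smul_eq_mul]
      ring
    rw [complex_smul_eq (t ^ 2), map_add, L.map_smul, L.map_smul, e1, e2, hN1, hN2, hB,
      ← Complex.normSq_eq_norm_sq, Complex.normSq_apply, pow_two t, Complex.mul_re,
      Complex.mul_im, smul_eq_mul, smul_eq_mul]
    linear_combination (t.re * t.re + t.im * t.im) / 4 * hlam

/-- The curves `t ↦ z + t • Y z + t² • c` lie on the side `r > r z` for `z` near `p`, if the Levi
form of `r` at `p` is positive in the complex tangential direction `X`. -/
theorem exists_discs_of_leviForm_pos {r : V → ℝ}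
    {p X : V} (hr : ContDiffAt ℝ 2 r p) (hdr : fderiv ℝ r p ≠ 0)
    (hX1 : fderiv ℝ r p X = 0) (hX2 : fderiv ℝ r p (Complex.I • X) = 0)
    (hpos : 0 < fderiv ℝ (fderiv ℝ r) p X X +
      fderiv ℝ (fderiv ℝ r) p (Complex.I • X) (Complex.I • X)) :
    ∃ (c : V) (κ ε : ℝ)
      (Y : V → V), 0 < κ ∧ 0 < ε ∧
      Tendsto Y (𝓝 p) (𝓝 X) ∧ ∀ᶠ z in 𝓝 p, ∀ t : ℂ, ‖t‖ ≤ ε →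
        r z + κ * ‖t‖ ^ 2 ≤ r (z + t • Y z + t ^ 2 • c) := by
  obtain ⟨B, hB⟩ : ∃ B, B = fderiv ℝ (fderiv ℝ r) p := ⟨_, rfl⟩
  rw [← hB] at hpos
  obtain ⟨lam, hlam⟩ : ∃ lam, B X X + B (Complex.I • X) (Complex.I • X) = 4 * lam :=
    ⟨_, (mul_div_cancel₀ _ four_ne_zero).symm⟩
  have hlam0 : 0 < lam := by linarith
  have hcont : ContinuousAt (fderiv ℝ r) p :=
    (hr.fderiv_right (m := 1) (by norm_num)).continuousAt
  obtain ⟨Y, hY, hYtan⟩ := exists_complexTangent_field hcont hdr hX1 hX2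
  obtain ⟨c, hquad⟩ := exists_quadratic_correction hdr B X hlam
  have hx : 0 ≤ ‖X‖ := norm_nonneg X
  obtain ⟨σ, hσ, hσ1, hσB⟩ := exists_pos_mul_le (a := ‖B‖ * (2 * ‖X‖ + 1)) (b := lam / 4)
    (by positivity) (by positivity)
  obtain ⟨η, hη, -, hηx⟩ := exists_pos_mul_le (a := (‖X‖ + 1) ^ 2) (b := lam / 8)
    (by positivity) (by positivity)
  obtain ⟨ρ, hρ, htaylor⟩ := hr.exists_second_order_estimate hη
  rw [← hB] at htaylor
  obtain ⟨ε₁, hε₁, -, hεc⟩ := exists_pos_mul_le (norm_nonneg c) (half_pos hσ)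
  obtain ⟨ε₂, hε₂, -, hερ⟩ := exists_pos_mul_le (a := ‖X‖ + 1) (by positivity) (half_pos hρ)
  have hYσ : ∀ᶠ z in 𝓝 p, ‖Y z - X‖ ≤ σ / 2 := by
    filter_upwards [hY (closedBall_mem_nhds X (half_pos hσ))] with z hz
    simpa [dist_eq_norm] using hz
  have hdrc : ∀ᶠ z in 𝓝 p, ‖fderiv ℝ r z - fderiv ℝ r p‖ * ‖c‖ ≤ lam / 8 := by
    have : Tendsto (fun z => ‖fderiv ℝ r z - fderiv ℝ r p‖ * ‖c‖) (𝓝 p) (𝓝 0) := by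
      have h := ((hcont.tendsto.sub_const (fderiv ℝ r p)).norm).mul_const ‖c‖
      simpa using h
    exact this.eventually_le_const (by positivity)
  -- Of the gain `lam * ‖t‖²`, at most `lam / 8` is lost to each of three errors: replacing `X` by
  -- `W = Y z + t c` in the Hessian, the variation of the gradient on `t² c`, and the Taylor
  -- remainder.
  refine ⟨c, lam / 2, min ε₁ ε₂, Y, by positivity, lt_min hε₁ hε₂, hY, ?_⟩
  filter_upwards [hYtan, hYσ, hdrc, ball_mem_nhds p (half_pos hρ)] with z hz1 hz2 hz3 hz4 t ht
  obtain ⟨W, hW⟩ : ∃ W, W = Y z + t • c := ⟨_, rfl⟩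
  have hWX : ‖W - X‖ ≤ σ := by
    have : W - X = (Y z - X) + t • c := by rw [hW]; abel
    rw [this]
    have h1 : ‖t • c‖ ≤ σ / 2 := by
      rw [norm_smul]
      exact (mul_le_mul_of_nonneg_right (ht.trans (min_le_left _ _)) (norm_nonneg _)).trans hεc
    linarith [norm_add_le (Y z - X) (t • c)]
  have hWn : ‖W‖ ≤ ‖X‖ + 1 := by
    have := norm_add_le X (W - X)
    rw [add_sub_cancel] at this
    linarith
  have hpt : z + t • Y z + t ^ 2 • c = z + t • W := by
    rw [hW, smul_add, smul_smul t t c, ← pow_two, add_assoc]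
  have hzh : z + t • W ∈ ball p ρ := by
    rw [mem_ball] at hz4 ⊢
    have h1 : dist (z + t • W) z ≤ ρ / 2 := by
      rw [dist_eq_norm, add_sub_cancel_left, norm_smul]
      exact (mul_le_mul (ht.trans (min_le_right _ _)) hWn (norm_nonneg _) hε₂.le).trans hερ
    linarith [dist_triangle (z + t • W) z p]
  have hT := neg_le_of_abs_le (htaylor z (t • W) (ball_subset_ball (by linarith) hz4) hzh)
  have hlin : fderiv ℝ r p (t ^ 2 • c) - lam / 8 * ‖t‖ ^ 2 ≤ fderiv ℝ r z (t • W) := by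
    have h1 : fderiv ℝ r z (t • W) = fderiv ℝ r z (t ^ 2 • c) := by
      rw [hW, smul_add, map_add, hz1, zero_add, smul_smul t t c, ← pow_two]
    have h2 := (fderiv ℝ r z - fderiv ℝ r p).le_opNorm (t ^ 2 • c)
    rw [norm_smul, norm_pow, sub_apply, Real.norm_eq_abs] at h2
    have h3 := neg_le_of_abs_le h2
    have h4 := mul_le_mul_of_nonneg_right hz3 (sq_nonneg ‖t‖)
    rw [h1]
    linarith
  have hBq := quadratic_perturbation B hσ1 hWX t
  have hBq' := mul_le_mul_of_nonneg_right hσB (sq_nonneg ‖t‖)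
  have hrem : η * ‖t • W‖ ^ 2 ≤ lam / 8 * ‖t‖ ^ 2 := by
    rw [norm_smul, mul_pow]
    calc η * (‖t‖ ^ 2 * ‖W‖ ^ 2) ≤ η * (‖t‖ ^ 2 * (‖X‖ + 1) ^ 2) := by gcongr
      _ = η * (‖X‖ + 1) ^ 2 * ‖t‖ ^ 2 := by ring
      _ ≤ _ := by gcongr
  rw [hpt]
  have := hquad t
  have : 0 ≤ lam * ‖t‖ ^ 2 := by positivity
  linarith

end

section

variable {n : ℕ}

/-- Near a boundary point with a positive Levi eigenvalue, every exterior point is the centre of an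
exterior disc of uniform size that reaches a fixed compact set of exterior points. -/
theorem exists_exterior_discs {D O : Set (EuclideanSpace ℂ (Fin n))}
    {p : EuclideanSpace ℂ (Fin n)} (hD : LeviFormHasPositiveEigenvalue D p) (hO : O ∈ 𝓝 p) :
    ∃ (c : EuclideanSpace ℂ (Fin n)) (ε m : ℝ) (Q : Set (EuclideanSpace ℂ (Fin n)))
      (Y : EuclideanSpace ℂ (Fin n) → EuclideanSpace ℂ (Fin n)), 0 < ε ∧ 0 < m ∧ IsCompact Q ∧
      Q ⊆ O \ closure D ∧ ∀ᶠ z in 𝓝 p, z ∉ closure D → m ≤ ‖Y z‖ ∧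
        (∀ t : ℂ, ‖t‖ ≤ ε → z + t • Y z + t ^ 2 • c ∈ O \ closure D) ∧
        z + ((ε / 2 : ℝ) : ℂ) • Y z + ((ε / 2 : ℝ) : ℂ) ^ 2 • c ∈ Q := by
  obtain ⟨r, ⟨U, hU, hpU, hr, hdr, hDU⟩, μ, hμ, X, hX, hX0, hL⟩ := hD
  -- Only the eigenvector equation tested on `Y = X` is needed: the sum equals `4 μ ‖X‖²`.
  have hpos : 0 < fderiv ℝ (fderiv ℝ r) p X X +
      fderiv ℝ (fderiv ℝ r) p (Complex.I • X) (Complex.I • X) := by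
    have h := congrArg Complex.re (hL X hX)
    have hn : 0 < ‖X‖ := norm_pos_iff.2 hX0
    rw [inner_self_eq_norm_sq_to_K] at h
    have h2 : ((μ : ℂ) * ((‖X‖ : ℝ) : ℂ) ^ 2).re = μ * ‖X‖ ^ 2 := by
      rw [← Complex.ofReal_pow, ← Complex.ofReal_mul, Complex.ofReal_re]
    have h3 : (leviForm r p X X).re = 1 / 4 * (fderiv ℝ (fderiv ℝ r) p X X +
        fderiv ℝ (fderiv ℝ r) p (Complex.I • X) (Complex.I • X)) := by
      simp [leviForm]
    have h4 := h3.symm.trans (h.trans h2)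
    have h5 : 0 < μ * ‖X‖ ^ 2 := by positivity
    linarith
  obtain ⟨c, κ, ε₀, Y, hκ, hε₀, hY, hev⟩ := exists_discs_of_leviForm_pos
    (hr.contDiffAt (hU.mem_nhds hpU)) hdr hX.1 hX.2 hpos
  obtain ⟨R, hR, hRU⟩ : ∃ R > 0, closedBall p R ⊆ U ∩ O :=
    Metric.nhds_basis_closedBall.mem_iff.1 (inter_mem (hU.mem_nhds hpU) hO)
  have hext : ∀ z ∈ U, 0 < r z → z ∉ closure D := by
    intro z hz hrz hzD
    have ho : IsOpen (U ∩ r ⁻¹' Ioi 0) := hr.continuousOn.isOpen_inter_preimage hU isOpen_Ioi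
    obtain ⟨w, ⟨hwU, hwr⟩, hwD⟩ := mem_closure_iff.1 hzD _ ho ⟨hz, hrz⟩
    have : w ∈ {z ∈ U | r z < 0} := hDU ▸ ⟨hwD, hwU⟩
    exact lt_asymm this.2 hwr
  have hext' : ∀ z ∈ U, z ∉ closure D → 0 ≤ r z := by
    intro z hz hzD
    by_contra! h
    have : z ∈ D ∩ U := hDU ▸ ⟨hz, h⟩
    exact hzD (subset_closure this.1)
  obtain ⟨ε₁, hε₁, hε₁1, hε₁R⟩ := exists_pos_mul_le (a := ‖X‖ + 1 + ‖c‖) (by positivity)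
    (half_pos hR)
  obtain ⟨ε, hε, hεε, hε1, hεR⟩ : ∃ ε > 0, ε ≤ ε₀ ∧ ε ≤ 1 ∧ ε * (‖X‖ + 1 + ‖c‖) ≤ R / 2 :=
    ⟨min ε₀ ε₁, lt_min hε₀ hε₁, min_le_left _ _, (min_le_right _ _).trans hε₁1,
      (mul_le_mul_of_nonneg_right (min_le_right _ _) (by positivity)).trans hε₁R⟩
  have hX0' : 0 < ‖X‖ := norm_pos_iff.2 hX0
  -- The compact set is the part of a closed ball where `r` is at least the growth guaranteed at `t
  -- = ε / 2`.
  refine ⟨c, ε, ‖X‖ / 2, closedBall p R ∩ r ⁻¹' Ici (κ * (ε / 2) ^ 2), Y, hε, by positivity,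
    ?_, ?_, ?_⟩
  · refine (isCompact_closedBall p R).of_isClosed_subset ?_ inter_subset_left
    exact (hr.continuousOn.mono fun z hz => (hRU hz).1).preimage_isClosed_of_isClosed
      isClosed_closedBall isClosed_Ici
  · rintro z ⟨hz, hzr⟩
    refine ⟨(hRU hz).2, hext z (hRU hz).1 (lt_of_lt_of_le ?_ hzr)⟩
    positivity
  · have hYn : ∀ᶠ z in 𝓝 p, ‖Y z‖ ≤ ‖X‖ + 1 :=
      hY.norm.eventually_le_const (by linarith)
    have hYm : ∀ᶠ z in 𝓝 p, ‖X‖ / 2 ≤ ‖Y z‖ := hY.norm.eventually_const_le (by linarith)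
    filter_upwards [hev, hYn, hYm, closedBall_mem_nhds p (half_pos hR)] with z h1 h2 h3 h4 hzD
    have hin : ∀ t : ℂ, ‖t‖ ≤ ε → z + t • Y z + t ^ 2 • c ∈ closedBall p R := by
      intro t ht
      rw [mem_closedBall] at h4 ⊢
      have hd : dist (z + t • Y z + t ^ 2 • c) z ≤ R / 2 := by
        rw [dist_eq_norm, add_assoc, add_sub_cancel_left]
        refine (norm_add_le _ _).trans (le_trans ?_ hεR)
        rw [norm_smul, norm_smul, norm_pow, mul_add]
        have : ‖t‖ ^ 2 ≤ ε := by nlinarith [norm_nonneg t]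
        gcongr
      linarith [dist_triangle (z + t • Y z + t ^ 2 • c) z p]
    have hz0 : 0 ≤ r z := hext' z (hRU (closedBall_subset_closedBall (by linarith) h4)).1 hzD
    refine ⟨h3, fun t ht => ⟨(hRU (hin t ht)).2, ?_⟩, ?_⟩
    · rcases eq_or_ne t 0 with rfl | ht0
      · simpa using hzD
      · refine hext _ (hRU (hin t ht)).1 (lt_of_lt_of_le ?_ (h1 t (ht.trans hεε)))
        have : 0 < ‖t‖ := norm_pos_iff.2 ht0
        positivity
    · have hn : ‖((ε / 2 : ℝ) : ℂ)‖ = ε / 2 := by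
        rw [Complex.norm_real, Real.norm_eq_abs, abs_of_pos (half_pos hε)]
      refine ⟨hin _ (by linarith), ?_⟩
      have := h1 ((ε / 2 : ℝ) : ℂ) (by linarith)
      rw [hn] at this
      exact le_trans (by linarith) this

end

/-! ### Connectedness of complements -/

/-- The map that adds `R` to the norm along each ray carries the punctured space onto the complement
of the ball. -/
theorem isPreconnected_compl_closedBall_zero {V : Type*} [NormedAddCommGroup V] [NormedSpace ℝ V]
    (hV : 1 < Module.rank ℝ V) {R : ℝ} (hR : 0 ≤ R) : IsPreconnected (closedBall (0 : V) R)ᶜ := by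
  have h := (isConnected_compl_singleton_of_one_lt_rank hV (0 : V)).isPreconnected.image
    (fun x => (R / ‖x‖ + 1) • x) (by
      refine ContinuousOn.smul (ContinuousOn.add (continuousOn_const.div continuousOn_id.norm ?_)
        continuousOn_const) continuousOn_id
      exact fun x hx => norm_ne_zero_iff.2 hx)
  convert h using 1
  ext y
  simp only [mem_compl_iff, mem_closedBall_zero_iff, not_le, mem_image, mem_singleton_iff]
  constructor
  · intro hy
    have hy0 : 0 < ‖y‖ := hR.trans_lt hy
    have hc : 0 < (‖y‖ - R) / ‖y‖ := div_pos (sub_pos.2 hy) hy0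
    refine ⟨((‖y‖ - R) / ‖y‖) • y, smul_ne_zero hc.ne' (norm_pos_iff.1 hy0), ?_⟩
    have h2 : ‖((‖y‖ - R) / ‖y‖) • y‖ = ‖y‖ - R := by
      rw [norm_smul, Real.norm_eq_abs, abs_of_pos hc, div_mul_cancel₀ _ hy0.ne']
    have h3 : ‖y‖ - R ≠ 0 := (sub_pos.2 hy).ne'
    rw [h2, smul_smul]
    have h4 : (R / (‖y‖ - R) + 1) * ((‖y‖ - R) / ‖y‖) = 1 := by
      field_simp
      ring
    rw [h4, one_smul]
  · rintro ⟨x, hx, rfl⟩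
    have hx0 : 0 < ‖x‖ := norm_pos_iff.2 hx
    rw [norm_smul, Real.norm_eq_abs, abs_of_pos (by positivity), add_mul,
      div_mul_cancel₀ _ hx0.ne', one_mul]
    linarith

/-- The mean value inequality for `‖·‖²` on the curve `t ↦ z + t • X + t² • c`, over the four points
`t = ±ε, ±iε`. -/
theorem norm_sq_add_le_of_disc {V : Type*} [NormedAddCommGroup V] [InnerProductSpace ℂ V]
    {z X c : V} {ε M : ℝ} (hε : 0 ≤ ε)
    (h : ∀ t : ℂ, ‖t‖ ≤ ε → ‖z + t • X + t ^ 2 • c‖ ≤ M) :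
    ‖z‖ ^ 2 + ε ^ 2 * ‖X‖ ^ 2 ≤ M ^ 2 := by
  have hn : ‖(ε : ℂ)‖ = ε := by rw [Complex.norm_real, Real.norm_eq_abs, abs_of_nonneg hε]
  have h' : ∀ t : ℂ, ‖t‖ ≤ ε → ‖z + t • X + t ^ 2 • c‖ ^ 2 ≤ M ^ 2 := fun t ht =>
    pow_le_pow_left₀ (norm_nonneg _) (h t ht) 2
  have h1 := h' ε hn.le
  have h2 := h' (-ε) (by rw [norm_neg, hn])
  have h3 := h' (Complex.I * ε) (by rw [norm_mul, Complex.norm_I, one_mul, hn])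
  have h4 := h' (-(Complex.I * ε)) (by rw [norm_neg, norm_mul, Complex.norm_I, one_mul, hn])
  set b := (ε : ℂ) ^ 2 • c with hb
  have e1 : z + (ε : ℂ) • X + (ε : ℂ) ^ 2 • c = (z + b) + (ε : ℂ) • X := by rw [hb]; abel
  have e2 : z + (-ε : ℂ) • X + (-ε : ℂ) ^ 2 • c = (z + b) - (ε : ℂ) • X := by
    rw [hb, neg_sq, neg_smul]; abel
  have e3 : z + (Complex.I * ε) • X + (Complex.I * ε) ^ 2 • c =
      (z - b) + (Complex.I * ε) • X := by
    rw [hb, mul_pow, Complex.I_sq, neg_one_mul, neg_smul]; abel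
  have e4 : z + (-(Complex.I * ε)) • X + (-(Complex.I * ε)) ^ 2 • c =
      (z - b) - (Complex.I * ε) • X := by
    rw [hb, neg_sq, mul_pow, Complex.I_sq, neg_one_mul, neg_smul, neg_smul]; abel
  rw [e1] at h1
  rw [e2] at h2
  rw [e3] at h3
  rw [e4] at h4
  -- Since `t² c` is `b` on the real pair and `-b` on the imaginary pair, the mean of the four
  -- squares is `‖z‖² + ‖b‖² + ε² ‖X‖²`.
  have p1 := parallelogram_law_with_norm ℂ (z + b) ((ε : ℂ) • X)
  have p2 := parallelogram_law_with_norm ℂ (z - b) ((Complex.I * ε) • X)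
  have p3 := parallelogram_law_with_norm ℂ z b
  rw [norm_smul, hn] at p1
  rw [norm_smul, norm_mul, Complex.norm_I, one_mul, hn] at p2
  nlinarith [sq_nonneg ‖b‖]

/-- If `K` is compact in a connected open set `G` and has a connected complement, then `G \ K` is
connected. -/
theorem IsPreconnected.diff_of_isPreconnected_compl {V : Type*} [NormedAddCommGroup V]
    [NormedSpace ℝ V] {G K : Set V} (hGo : IsOpen G) (hG : IsPreconnected G) (hK : IsCompact K)
    (hKG : K ⊆ G) (hKne : K.Nonempty) (hKc : IsPreconnected Kᶜ) : IsPreconnected (G \ K) := by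
  classical
  intro u v hu hv hcov hAne hBne
  obtain ⟨a, haGK, hau⟩ := hAne
  obtain ⟨b, hbGK, hbv⟩ := hBne
  by_contra hne
  have hdisj : ∀ x ∈ G \ K, x ∈ u → x ∉ v := fun x hx hxu hxv => hne ⟨x, hx, hxu, hxv⟩
  have hGKo : IsOpen (G \ K) := hGo.sdiff hK.isClosed
  have hpath : IsPathConnected Kᶜ :=
    (hK.isClosed.isOpen_compl.isConnected_iff_isPathConnected).1 ⟨⟨a, haGK.2⟩, hKc⟩
  obtain ⟨γ, hγ⟩ := hpath.joinedIn a haGK.2 b hbGK.2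
  have hPc : IsCompact (range γ) := isCompact_range γ.continuous
  obtain ⟨δ, hδ, hδs⟩ := hK.exists_cthickening_subset_open
    (hGo.inter hPc.isClosed.isOpen_compl) (fun x hx => ⟨hKG hx, by
      rintro ⟨s, rfl⟩
      exact hγ s hx⟩)
  -- A cutoff that is `0` on `K` and `1` off a neighbourhood of `K` lying in `G` and missing the
  -- path from `a` to `b`.
  let ψ : V → ℝ := fun x => min 1 (infDist x K / δ)
  have hψc : Continuous ψ :=
    continuous_const.min ((continuous_infDist_pt K).div_const δ)
  have hψK : ∀ x ∈ K, ψ x = 0 := fun x hx => by simp [ψ, infDist_zero_of_mem hx]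
  have hψ1 : ∀ x, x ∉ cthickening δ K → ψ x = 1 := by
    intro x hx
    refine min_eq_left ((one_le_div hδ).2 ?_)
    by_contra! h
    exact hx (thickening_subset_cthickening δ K
      ((mem_thickening_iff_infDist_lt hKne).2 h))
  set A := (G \ K) ∩ u
  have hAo : IsOpen A := hGKo.inter hu
  have hfront : ∀ x ∈ frontier A, x ∉ G \ K := by
    intro x hx hxGK
    have hxA : x ∉ A := fun h => by
      rw [hAo.frontier_eq] at hx
      exact hx.2 h
    have hxv : x ∈ v := (hcov hxGK).resolve_left fun h => hxA ⟨hxGK, h⟩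
    obtain ⟨y, ⟨hyGK, hyv⟩, hyA⟩ := mem_closure_iff.1 (frontier_subset_closure hx) _
      (hGKo.inter hv) ⟨hxGK, hxv⟩
    exact hdisj y hyGK hyA.2 hyv
  -- Modulo `1`, cutting `ψ` off outside `A` is continuous: a frontier point of `A` lies in `K`,
  -- where `ψ = 0`, or outside `G`, where `ψ = 1`.
  let f : C(V, AddCircle (1 : ℝ)) :=
    ⟨fun x => if x ∈ A then ((ψ x : ℝ) : AddCircle (1 : ℝ)) else 0, by
      refine Continuous.if ?_ ((AddCircle.continuous_mk' 1).comp hψc) continuous_const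
      intro x hx
      by_cases hxK : x ∈ K
      · simp [hψK x hxK]
      · have hxG : x ∉ G := fun h => hfront x hx ⟨h, hxK⟩
        rw [hψ1 x fun h => hxG (hδs h).1]
        exact AddCircle.coe_period 1⟩
  obtain ⟨θ, ⟨-, hθ⟩, -⟩ := (AddCircle.isCoveringMap_coe (1 : ℝ)).existsUnique_continuousMap_lifts
    f b 0 (by
      have : b ∉ A := fun h => hdisj b hbGK h.2 hbv
      simp [f, this])
  have hθ' : ∀ x, ((θ x : ℝ) : AddCircle (1 : ℝ)) = f x := fun x => congrFun hθ x
  have hdiscrete : IsDiscrete (AddSubgroup.zmultiples (1 : ℝ) : Set ℝ) :=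
    ⟨inferInstanceAs (DiscreteTopology (AddSubgroup.zmultiples (1 : ℝ)))⟩
  have hint : ∀ y : ℝ, ((y : ℝ) : AddCircle (1 : ℝ)) = 0 →
      y ∈ (AddSubgroup.zmultiples (1 : ℝ) : Set ℝ) := fun y hy => by
    obtain ⟨m, hm⟩ := (AddCircle.coe_eq_zero_iff 1).1 hy
    exact ⟨m, hm⟩
  have hPout : ∀ x ∈ range γ, x ∉ cthickening δ K := fun x hx h => (hδs h).2 hx
  -- Along the path `f` vanishes, so the lift is integer-valued there and hence constant.
  have hθab : θ a = θ b := by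
    refine (isPreconnected_range γ.continuous).constant_of_mapsTo
      (T := (AddSubgroup.zmultiples (1 : ℝ) : Set ℝ)) hdiscrete θ.continuous.continuousOn ?_
      ⟨0, γ.source⟩ ⟨1, γ.target⟩
    intro x hx
    refine hint _ ?_
    rw [hθ']
    simp only [f, ContinuousMap.coe_mk]
    split_ifs
    · rw [hψ1 x (hPout x hx)]
      exact AddCircle.coe_period 1
    · rfl
  -- On `G` itself the cut-off function is continuous with real values, so `θ - g` is
  -- integer-valued, hence constant on `G`. This contradicts `θ a = θ b`, since `g a = 1` and `g b =
  -- 0`.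
  let g : V → ℝ := fun x => if x ∈ A then ψ x else 0
  have hgc : ContinuousOn g G := by
    refine ContinuousOn.if ?_ hψc.continuousOn continuousOn_const
    rintro x ⟨hxG, hx⟩
    by_contra h
    exact hfront x hx ⟨hxG, fun hxK => h (hψK x hxK)⟩
  have hθg : θ a - g a = θ b - g b := by
    refine hG.constant_of_mapsTo (T := (AddSubgroup.zmultiples (1 : ℝ) : Set ℝ))
      (f := fun x => θ x - g x) hdiscrete (θ.continuous.continuousOn.sub hgc) ?_ haGK.1 hbGK.1
    intro x hx
    refine hint _ ?_
    rw [AddCircle.coe_sub, hθ']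
    simp only [f, g, ContinuousMap.coe_mk]
    split_ifs <;> simp
  have hga : g a = 1 := by
    simp only [g]
    rw [if_pos ⟨haGK, hau⟩]
    exact hψ1 a (hPout a ⟨0, γ.source⟩)
  have hgb : g b = 0 := if_neg fun h => hdisj b hbGK h.2 hbv
  rw [hga, hgb, hθab] at hθg
  linarith

section

variable {n : ℕ} {D : Set (EuclideanSpace ℂ (Fin n))}

/-- A connected component of the exterior of `D` is unbounded: at the farthest point of a bounded
component the exterior discs would contradict the mean value inequality. -/
theorem not_connectedComponentIn_compl_subset_closedBall [Nontrivial (EuclideanSpace ℂ (Fin n))]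
    (hDo : IsOpen D) (hlevi : ∀ p ∈ frontier D, LeviFormHasPositiveEigenvalue D p)
    {z : EuclideanSpace ℂ (Fin n)} (hz : z ∉ closure D) (R : ℝ) :
    ¬ connectedComponentIn (closure D)ᶜ z ⊆ closedBall 0 R := by
  intro hR
  set W := connectedComponentIn (closure D)ᶜ z
  have hzW : z ∈ W := mem_connectedComponentIn hz
  have hWK : W ⊆ (closure D)ᶜ := connectedComponentIn_subset _ _
  have hWo : IsOpen W := isClosed_closure.isOpen_compl.connectedComponentIn
  have hWc : IsPreconnected W := isPreconnected_connectedComponentIn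
  have hmax : ∀ S ⊆ (closure D)ᶜ, IsPreconnected S → (S ∩ W).Nonempty → S ⊆ W := by
    rintro S hS hSc ⟨x, hxS, hxW⟩
    have := hSc.subset_connectedComponentIn hxS hS
    rwa [← connectedComponentIn_eq hxW] at this
  have hWcl : IsCompact (closure W) := (isCompact_closedBall 0 R).of_isClosed_subset
    isClosed_closure (closure_minimal hR isClosed_closedBall)
  obtain ⟨p, hp, hpmax⟩ := hWcl.exists_isMaxOn ⟨z, subset_closure hzW⟩ continuous_norm.continuousOn
  have hpmax : ∀ w ∈ W, ‖w‖ ≤ ‖p‖ := fun w hw => hpmax (subset_closure hw)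
  -- The norm has no interior maximum: apply the mean value inequality to a straight disc through
  -- `p`.
  have hpW : p ∉ W := by
    intro hpW
    obtain ⟨ρ, hρ, hb⟩ := Metric.isOpen_iff.1 hWo p hpW
    obtain ⟨X, hX⟩ := exists_ne (0 : EuclideanSpace ℂ (Fin n))
    have hX0 : 0 < ‖X‖ := norm_pos_iff.2 hX
    obtain ⟨ε, hε, -, hεX⟩ := exists_pos_mul_le (norm_nonneg X) (half_pos hρ)
    have h := norm_sq_add_le_of_disc (z := p) (X := X) (c := 0) (M := ‖p‖) hε.le (fun t ht => by
      refine hpmax _ (hb ?_)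
      rw [mem_ball, dist_eq_norm, smul_zero, add_zero, add_sub_cancel_left, norm_smul]
      have := mul_le_mul_of_nonneg_right ht hX0.le
      linarith)
    have : 0 < ε ^ 2 * ‖X‖ ^ 2 := by positivity
    linarith
  -- Otherwise adjoining the limit point `p` to `W` would give a larger connected subset of the
  -- complement.
  have hpK : p ∈ closure D := by
    by_contra hpK
    refine hpW (hmax (insert p W) (insert_subset hpK hWK) ?_ ⟨z, mem_insert_of_mem _ hzW, hzW⟩
      (mem_insert p W))
    exact hWc.subset_closure (subset_insert _ _) (insert_subset hp subset_closure)
  have hpf : p ∈ frontier D := by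
    rw [hDo.frontier_eq]
    refine ⟨hpK, fun hpD => ?_⟩
    obtain ⟨w, hwD, hwW⟩ := mem_closure_iff.1 hp D hDo hpD
    exact hWK hwW (subset_closure hwD)
  obtain ⟨c, ε, m, Q, Y, hε, hm, -, -, hev⟩ := exists_exterior_discs (hlevi p hpf) univ_mem
  have hnear : ∀ᶠ w in 𝓝 p, ‖p‖ ^ 2 - ε ^ 2 * m ^ 2 < ‖w‖ ^ 2 := by
    have hc : Continuous fun w : EuclideanSpace ℂ (Fin n) => ‖w‖ ^ 2 := by fun_prop
    refine hc.continuousAt.eventually_const_lt ?_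
    have : 0 < ε ^ 2 * m ^ 2 := by positivity
    linarith
  -- For `w ∈ W` close to `p`, the whole exterior disc at `w` stays in the component `W`. The norm
  -- is at most `‖p‖` on it, while `‖w‖²` falls short of `‖p‖²` by less than `ε² m²`.
  obtain ⟨w, hwW, hw1, hw2⟩ :=
    ((mem_closure_iff_frequently.1 hp).and_eventually (hnear.and hev)).exists
  obtain ⟨hmY, hdisc, -⟩ := hw2 (hWK hwW)
  have hS : (fun t : ℂ => w + t • Y w + t ^ 2 • c) '' closedBall 0 ε ⊆ W := by
    refine hmax _ ?_ ?_ ⟨w, ⟨0, by simpa using hε.le, by simp⟩, hwW⟩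
    · rintro _ ⟨t, ht, rfl⟩
      exact (hdisc t (by simpa using ht)).2
    · exact (isConnected_closedBall hε.le).isPreconnected.image _ (by fun_prop)
  have h := norm_sq_add_le_of_disc (z := w) (X := Y w) (c := c) (M := ‖p‖) hε.le (fun t ht =>
    hpmax _ (hS ⟨t, by simpa using ht, rfl⟩))
  have : ε ^ 2 * m ^ 2 ≤ ε ^ 2 * ‖Y w‖ ^ 2 := by gcongr
  linarith

/-- Every component of the complement leaves a large ball, and the exterior of that ball is
connected because the real dimension exceeds one. -/
theorem isPreconnected_compl_closure_of_levi (hn : 2 ≤ n) (hDo : IsOpen D)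
    (hDc : IsCompact (closure D))
    (hlevi : ∀ p ∈ frontier D, LeviFormHasPositiveEigenvalue D p) :
    IsPreconnected (closure D)ᶜ := by
  have hrank : 1 < Module.rank ℝ (EuclideanSpace ℂ (Fin n)) := by
    rw [← Module.finrank_eq_rank]
    have := finrank_real_of_complex (EuclideanSpace ℂ (Fin n))
    rw [finrank_euclideanSpace_fin] at this
    rw [this]
    exact_mod_cast (by omega : 1 < 2 * n)
  have : Nontrivial (EuclideanSpace ℂ (Fin n)) :=
    Module.nontrivial_of_finrank_pos (R := ℂ) (by rw [finrank_euclideanSpace_fin]; omega)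
  obtain ⟨R, hR0, hR⟩ := hDc.isBounded.subset_closedBall_lt 0 0
  have hout : (closedBall 0 R)ᶜ ⊆ (closure D)ᶜ := compl_subset_compl.2 hR
  have hA := isPreconnected_compl_closedBall_zero hrank hR0.le
  obtain ⟨x, hx⟩ : ((closedBall (0 : EuclideanSpace ℂ (Fin n)) R)ᶜ).Nonempty := by
    by_contra h
    rw [not_nonempty_iff_eq_empty, compl_empty_iff] at h
    exact NormedSpace.unbounded_univ ℝ (EuclideanSpace ℂ (Fin n)) (h ▸ isBounded_closedBall)
  refine isPreconnected_of_forall x fun z hz =>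
    ⟨(closedBall 0 R)ᶜ ∪ connectedComponentIn (closure D)ᶜ z,
      union_subset hout (connectedComponentIn_subset _ _), Or.inl hx,
      Or.inr (mem_connectedComponentIn hz), ?_⟩
  obtain ⟨w, hw, hwR⟩ := not_subset.1
    (not_connectedComponentIn_compl_subset_closedBall hDo hlevi hz R)
  exact hA.union w hwR hw isPreconnected_connectedComponentIn

end

/-! ### Comparison of the Kobayashi distances of `G` and `G \ closure D` -/

/-- Let `b` be the left side and `r = tanh ρ`. The addition formula expresses `tanh (b - a)` through
`tanh a` and `r` and bounds it by `2 a (r⁻¹ - 1)`; `artanh s ≤ 2 s` for small `s` gives the second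
factor two. -/
theorem artanh_tanh_div_tanh_le {a ρ : ℝ} (ha : 0 ≤ a) (hρ : 0 < ρ)
    (haρ : Real.tanh a ≤ Real.tanh ρ / 2) :
    Real.artanh (Real.tanh a / Real.tanh ρ) ≤ a * (1 + 4 * ((Real.tanh ρ)⁻¹ - 1)) := by
  have hτ := tanh_nonneg_of_nonneg ha
  have hτa := tanh_le_self ha
  have hr : 0 < Real.tanh ρ := by
    rw [← Real.tanh_zero]
    exact tanh_strictMono hρ
  have hr1 := Real.tanh_lt_one ρ
  set r := Real.tanh ρ
  set τ := Real.tanh a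
  have hq0 : 0 ≤ τ / r := by positivity
  have hq : τ / r ≤ 1 / 2 := by rw [div_le_iff₀ hr]; linarith
  have hτq : τ ≤ τ / r := by rw [le_div_iff₀ hr]; nlinarith
  set b := Real.artanh (τ / r)
  have hb : Real.tanh b = τ / r := Real.tanh_artanh ⟨by linarith, by linarith⟩
  have hab : a ≤ b := by
    rw [← tanh_strictMono.le_iff_le, hb]
    exact hτq
  have hadd := tanh_add_formula a (b - a)
  rw [add_sub_cancel, hb] at hadd
  set s := Real.tanh (b - a)
  have hs0 : 0 ≤ s := tanh_nonneg_of_nonneg (sub_nonneg.2 hab)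
  have hden : 0 < 1 + τ * s := by positivity
  have hs : s * (1 - τ * (τ / r)) = τ / r - τ := by
    rw [eq_div_iff hden.ne'] at hadd
    linear_combination -hadd
  have hle : 1 / 2 ≤ 1 - τ * (τ / r) := by nlinarith
  have hs2 : s ≤ 2 * (τ / r - τ) := by nlinarith
  have hs12 : s ≤ 1 / 2 := by
    have : s * (1 - τ * (τ / r)) ≤ 1 / 2 * (1 - τ * (τ / r)) := by
      rw [hs]
      nlinarith
    exact le_of_mul_le_mul_right this (by linarith)
  have hd := artanh_le_two_mul hs0 hs12
  have hbs : Real.artanh s = b - a := Real.artanh_tanh _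
  have hinv : 0 ≤ r⁻¹ - 1 := by
    have := one_le_inv₀ hr |>.2 hr1.le
    linarith
  have hfin : τ / r - τ ≤ a * (r⁻¹ - 1) := by
    have : τ / r - τ = τ * (r⁻¹ - 1) := by rw [div_eq_mul_inv]; ring
    rw [this]
    gcongr
  linarith

theorem inv_tanh_sub_one_le {ρ₀ ρ : ℝ} (h0 : 0 < ρ₀) (h : ρ₀ ≤ ρ) :
    (Real.tanh ρ)⁻¹ - 1 ≤ 2 / (1 - Real.exp (-2 * ρ₀)) * Real.exp (-2 * ρ) := by
  have e0 : Real.exp (-2 * ρ₀) < 1 := Real.exp_lt_one_iff.2 (by linarith)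
  have e1 : Real.exp (-2 * ρ) ≤ Real.exp (-2 * ρ₀) := Real.exp_le_exp.2 (by linarith)
  have e2 : Real.exp (-ρ) = Real.exp ρ * Real.exp (-2 * ρ) := by
    rw [← Real.exp_add]
    congr 1
    ring
  have hp := Real.exp_pos ρ
  have hp2 := Real.exp_pos (-2 * ρ)
  set E := Real.exp (-2 * ρ)
  have h1 : (Real.tanh ρ)⁻¹ - 1 = 2 / (1 - E) * E := by
    have : 1 - E ≠ 0 := by linarith
    rw [Real.tanh_eq, e2]
    field_simp
    ring
  rw [h1]
  gcongr

section

variable {n : ℕ} {G D K L G' : Set (EuclideanSpace ℂ (Fin n))}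

/-- A disc step of `G` whose centre is at distance at least `ρ` from `K` is a disc step of
`G \ K`, up to a factor close to one for large `ρ`. -/
theorem IsDiscStep.kobayashiLE_diff {x y : EuclideanSpace ℂ (Fin n)} {a ρ : ℝ}
    (h : IsDiscStep G x y a) (hρ : 0 < ρ)
    (hK : ∀ q ∈ K, ∀ T, 0 ≤ T → KobayashiLE G x q T → ρ ≤ T)
    (ha : Real.tanh a ≤ Real.tanh ρ / 2) :
    KobayashiLE (G \ K) x y (a * (1 + 4 * ((Real.tanh ρ)⁻¹ - 1))) := by
  obtain ⟨ha0, φ, hφ, hm, rfl, rfl⟩ := h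
  have hr : 0 < Real.tanh ρ := by
    rw [← Real.tanh_zero]
    exact tanh_strictMono hρ
  have hr1 := Real.tanh_lt_one ρ
  have hlt : ∀ ζ ∈ ball (0 : ℂ) 1, ‖((Real.tanh ρ : ℝ) : ℂ) * ζ‖ < Real.tanh ρ := by
    intro ζ hζ
    rw [mem_ball_zero_iff] at hζ
    rw [norm_mul, Complex.norm_real, Real.norm_eq_abs, abs_of_pos hr]
    nlinarith
  have hmaps : MapsTo (fun ζ : ℂ => ((Real.tanh ρ : ℝ) : ℂ) * ζ) (ball 0 1) (ball 0 1) :=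
    fun ζ hζ => mem_ball_zero_iff.2 ((hlt ζ hζ).trans hr1)
  have hψ : DifferentiableOn ℂ (fun ζ => φ (((Real.tanh ρ : ℝ) : ℂ) * ζ)) (ball 0 1) :=
    hφ.comp (differentiable_id.const_mul _).differentiableOn hmaps
  -- Points of the shrunken disc are at distance less than `ρ` from its centre, hence not in `K`.
  have hψm : MapsTo (fun ζ => φ (((Real.tanh ρ : ℝ) : ℂ) * ζ)) (ball 0 1) (G \ K) := by
    intro ζ hζ
    refine ⟨hm (hmaps hζ), fun hq => ?_⟩
    have hs := isDiscStep_artanh hφ hm (hmaps hζ)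
    have h1 := hK _ hq _ hs.1 hs.kobayashiLE
    have h2 : Real.artanh ‖((Real.tanh ρ : ℝ) : ℂ) * ζ‖ < Real.artanh (Real.tanh ρ) :=
      Real.artanh_lt_artanh (by linarith [norm_nonneg (((Real.tanh ρ : ℝ) : ℂ) * ζ)]) hr1
        (hlt ζ hζ)
    rw [Real.artanh_tanh] at h2
    linarith
  have hτ := tanh_nonneg_of_nonneg ha0
  have hα : ‖((Real.tanh a / Real.tanh ρ : ℝ) : ℂ)‖ = Real.tanh a / Real.tanh ρ := by
    rw [Complex.norm_real, Real.norm_eq_abs, abs_of_nonneg (by positivity)]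
  have hα1 : ((Real.tanh a / Real.tanh ρ : ℝ) : ℂ) ∈ ball (0 : ℂ) 1 := by
    rw [mem_ball_zero_iff, hα, div_lt_one hr]
    linarith
  have hs := (isDiscStep_artanh hψ hψm hα1).kobayashiLE
  rw [hα, ← Complex.ofReal_mul, mul_div_cancel₀ _ hr.ne', mul_zero] at hs
  exact hs.mono (artanh_tanh_div_tanh_le ha0 hρ ha)

theorem exists_kobayashi_function (ho : IsOpen G) (hc : IsPreconnected G) :
    ∃ d : EuclideanSpace ℂ (Fin n) → EuclideanSpace ℂ (Fin n) → ℝ, ∀ x ∈ G, ∀ y ∈ G,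
      0 ≤ d x y ∧ KobayashiLE G x y (d x y) ∧ ∀ T, 0 ≤ T → KobayashiLE G x y T → d x y ≤ T := by
  classical
  refine ⟨fun x y => if h : x ∈ G ∧ y ∈ G then kobayashiDist G ⟨x, h.1⟩ ⟨y, h.2⟩ else 0,
    fun x hx y hy => ?_⟩
  beta_reduce
  rw [dif_pos ⟨hx, hy⟩]
  exact ⟨kobayashiDist_nonneg _ _, kobayashiLE_kobayashiDist ho hc ⟨x, hx⟩ ⟨y, hy⟩,
    fun T hT h => KobayashiLE.kobayashiDist_le (x := ⟨x, hx⟩) (y := ⟨y, hy⟩) hT h⟩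

/-- Chains of short disc steps of `G` along which the distance `κ` to a base point grows linearly
are chains of `G'`, up to a bounded additive error. -/
theorem kobayashiLE_of_growing_chain {κ : EuclideanSpace ℂ (Fin n) → ℝ} {ε C b : ℝ} (hC : 0 ≤ C)
    (hcost : ∀ x y a s, IsDiscStep G x y a → a ≤ ε → x ∉ L → s ≤ κ x →
      KobayashiLE G' x y (a * (1 + C * Real.exp (-2 * s))))
    {N : ℕ} {p : ℕ → EuclideanSpace ℂ (Fin n)} {S : ℕ → ℝ}
    (hstep : ∀ i < N, IsDiscStep G (p i) (p (i + 1)) (S (i + 1) - S i) ∧ S (i + 1) - S i ≤ ε)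
    (hbase : p 0 ∈ G') (hout : ∀ i < N, p (i + 1) ∉ L)
    (hgrow : ∀ i < N, (S (i + 1) - S 0 - b) / 2 ≤ κ (p (i + 1))) :
    KobayashiLE G' (p 0) (p N) (S N - S 0 + C * Real.exp b) := by
  have hCb : 0 ≤ C * Real.exp b := by positivity
  -- The excess telescopes: a step of length `Δ` adds at most `C e^b Δ e^{-S'}`, with `S'` the
  -- length after the step. By `1 + Δ ≤ e^Δ` this is at most `C e^b (e^{-(S' - Δ)} - e^{-S'})`.
  have key : ∀ k ≤ N, 0 ≤ S k - S 0 ∧ KobayashiLE G' (p 0) (p k)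
      (S k - S 0 + C * Real.exp b * (1 - Real.exp (-(S k - S 0)))) := by
    intro k
    induction k with
    | zero => exact fun _ => ⟨by simp, by simpa using KobayashiLE.refl hbase⟩
    | succ k ih =>
      intro hk
      obtain ⟨hnn, ih⟩ := ih (by omega)
      obtain ⟨hs, ha⟩ := hstep k hk
      -- The step is reversed so that its cost is measured at the far endpoint; the starting point
      -- `p 0` may lie in `L`.
      have h := (hcost _ _ _ _ hs.symm ha (hout k hk) (hgrow k hk)).symm
      have ha0 := hs.1
      refine ⟨by linarith, (ih.trans h ?_ ?_).mono ?_⟩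
      · have : Real.exp (-(S k - S 0)) ≤ 1 := Real.exp_le_one_iff.2 (by linarith)
        nlinarith
      · positivity
      · have e1 : Real.exp (-2 * ((S (k + 1) - S 0 - b) / 2)) =
            Real.exp b * Real.exp (-(S (k + 1) - S 0)) := by
          rw [← Real.exp_add]
          congr 1
          ring
        have e2 : Real.exp (-(S k - S 0)) =
            Real.exp (-(S (k + 1) - S 0)) * Real.exp (S (k + 1) - S k) := by
          rw [← Real.exp_add]
          congr 1
          ring
        have e3 := Real.add_one_le_exp (S (k + 1) - S k)
        have e4 : 0 ≤ C * Real.exp b * Real.exp (-(S (k + 1) - S 0)) := by positivity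
        rw [e1, e2]
        nlinarith [mul_le_mul_of_nonneg_left e3 e4]
  refine (key N le_rfl).2.mono ?_
  have := Real.exp_pos (-(S N - S 0))
  nlinarith

/-- A chain of disc steps of `G` is short in `G'`, if the parts before `p i₀` and after `p j₀` stay
outside `L` and move away from the base point, and the middle part has close endpoints in `G'`. -/
theorem kobayashiLE_of_split_chain {κ : EuclideanSpace ℂ (Fin n) → ℝ} {ε C b M : ℝ} (hC : 0 ≤ C)
    (hM : 0 ≤ M)
    (hcost : ∀ x y a s, IsDiscStep G x y a → a ≤ ε → x ∉ L → s ≤ κ x →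
      KobayashiLE G' x y (a * (1 + C * Real.exp (-2 * s))))
    {N : ℕ} {p : ℕ → EuclideanSpace ℂ (Fin n)} {S : ℕ → ℝ} (hmono : ∀ i j, i ≤ j → j ≤ N → S i ≤ S j)
    (hstep : ∀ i < N, IsDiscStep G (p i) (p (i + 1)) (S (i + 1) - S i) ∧ S (i + 1) - S i ≤ ε)
    {i₀ j₀ : ℕ} (hij : i₀ ≤ j₀) (hjN : j₀ ≤ N) (hi₀ : p i₀ ∈ G') (hj₀ : p j₀ ∈ G')
    (hmid : KobayashiLE G' (p i₀) (p j₀) M)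
    (houti : ∀ i < i₀, p i ∉ L) (houtj : ∀ j, j₀ < j → j ≤ N → p j ∉ L)
    (hgrowi : ∀ i < i₀, (S i₀ - S i - b) / 2 ≤ κ (p i))
    (hgrowj : ∀ j, j₀ < j → j ≤ N → (S j - S j₀ - b) / 2 ≤ κ (p j)) :
    KobayashiLE G' (p 0) (p N) (S N - S 0 + (2 * (C * Real.exp b) + M)) := by
  have h1 : KobayashiLE G' (p i₀) (p 0) (S i₀ - S 0 + C * Real.exp b) := by
    -- The initial part is run backwards from `p i₀`, with `-S (i₀ - i)` as increasing partial sums.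
    have := kobayashiLE_of_growing_chain (b := b) hC hcost (N := i₀) (p := fun i => p (i₀ - i))
      (S := fun i => -S (i₀ - i)) (fun i hi => ?_) hi₀ (fun i hi => houti _ (by omega))
      (fun i hi => ?_)
    · rw [Nat.sub_zero, Nat.sub_self] at this
      exact this.mono (by linarith)
    · obtain ⟨h, h'⟩ := hstep (i₀ - (i + 1)) (by omega)
      have e : i₀ - (i + 1) + 1 = i₀ - i := by omega
      rw [e] at h h'
      have e2 : -S (i₀ - (i + 1)) - -S (i₀ - i) = S (i₀ - i) - S (i₀ - (i + 1)) := by ring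
      rw [e2]
      exact ⟨h.symm, h'⟩
    · have := hgrowi (i₀ - (i + 1)) (by omega)
      rw [Nat.sub_zero]
      linarith
  have h2 : KobayashiLE G' (p j₀) (p N) (S N - S j₀ + C * Real.exp b) := by
    have := kobayashiLE_of_growing_chain (b := b) hC hcost (N := N - j₀) (p := fun i => p (j₀ + i))
      (S := fun i => S (j₀ + i)) (fun i hi => hstep (j₀ + i) (by omega)) hj₀
      (fun i hi => houtj _ (by omega) (by omega))
      (fun i hi => hgrowj (j₀ + (i + 1)) (by omega) (by omega))
    rwa [Nat.add_sub_cancel' hjN, add_zero] at this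
  have hCb : 0 ≤ C * Real.exp b := by positivity
  have m1 := hmono 0 i₀ (by omega) (by omega)
  have m2 := hmono i₀ j₀ hij hjN
  have m3 := hmono j₀ N hjN le_rfl
  exact ((h1.symm.trans hmid (by linarith) hM).trans h2 (by linarith) (by linarith)).mono
    (by linarith)

theorem kobayashiLE_of_chain {N : ℕ} {p : ℕ → EuclideanSpace ℂ (Fin n)} {S : ℕ → ℝ}
    (hm : ∀ i ≤ N, p i ∈ G)
    (hstep : ∀ i < N, IsDiscStep G (p i) (p (i + 1)) (S (i + 1) - S i)) (i j : ℕ) (hij : i ≤ j)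
    (hj : j ≤ N) : 0 ≤ S j - S i ∧ KobayashiLE G (p i) (p j) (S j - S i) := by
  induction j, hij using Nat.le_induction with
  | base => simpa using KobayashiLE.refl (hm i hj)
  | succ j hij ih =>
    obtain ⟨h1, h2⟩ := ih (by omega)
    have hs := hstep j hj
    refine ⟨by linarith [hs.1], ?_⟩
    exact (h2.trans hs.kobayashiLE h1 hs.1).mono (by linarith)

/-- If points outside `L` have a positive distance from `K`, and the part `L \ K` is bounded in
`G \ K`, then the Kobayashi distances of `G` and of `G \ K` differ by a bounded amount. -/
theorem exists_kobayashiLE_diff_of_kobayashiLE (hGo : IsOpen G) (hGc : IsPreconnected G)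
    {ρ₀ R R' : ℝ} {o o' : EuclideanSpace ℂ (Fin n)} (ho : o ∈ G) (hKL : K ⊆ L) (hρ₀ : 0 < ρ₀)
    (hR : 0 ≤ R) (hR' : 0 ≤ R')
    (hfar : ∀ x, x ∉ L → ∀ q ∈ K, ∀ T, 0 ≤ T → KobayashiLE G x q T → ρ₀ ≤ T)
    (hL : ∀ x ∈ L, KobayashiLE G o x R) (hLK : ∀ x ∈ L \ K, KobayashiLE (G \ K) o' x R') :
    ∃ M, 0 ≤ M ∧ ∀ x ∈ G \ K, ∀ y ∈ G \ K, ∀ T, 0 ≤ T → KobayashiLE G x y T →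
      KobayashiLE (G \ K) x y (T + M) := by
  classical
  obtain ⟨d, hd⟩ := exists_kobayashi_function hGo hGc
  have hsymm : ∀ x ∈ G, ∀ y ∈ G, d x y ≤ d y x := fun x hx y hy =>
    (hd x hx y hy).2.2 _ (hd y hy x hx).1 (hd y hy x hx).2.1.symm
  have htri : ∀ x ∈ G, ∀ y ∈ G, ∀ z ∈ G, d x z ≤ d x y + d y z := fun x hx y hy z hz =>
    (hd x hx z hz).2.2 _ (add_nonneg (hd x hx y hy).1 (hd y hy z hz).1)
      ((hd x hx y hy).2.1.trans (hd y hy z hz).2.1 (hd x hx y hy).1 (hd y hy z hz).1)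
  have hdL : ∀ x ∈ L, d o x ≤ R := fun x hx => by
    obtain ⟨_, hxG, _⟩ := hL x hx
    exact (hd o ho x hxG).2.2 R hR (hL x hx)
  have htρ₀ : 0 < Real.tanh ρ₀ := by
    rw [← Real.tanh_zero]
    exact tanh_strictMono hρ₀
  -- Steps this short satisfy the smallness condition for shrinking discs, and being shorter than
  -- `ρ₀` they cannot lead from outside `L` into `K`.
  obtain ⟨ε, hε⟩ : ∃ ε, ε = Real.tanh ρ₀ / 2 := ⟨_, rfl⟩
  have hε0 : 0 < ε := by rw [hε]; positivity
  have hερ : ε < ρ₀ := by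
    have := tanh_le_self hρ₀.le
    linarith
  have hexp : 0 < 1 - Real.exp (-2 * ρ₀) := sub_pos.2 (Real.exp_lt_one_iff.2 (by linarith))
  obtain ⟨C, hC⟩ : ∃ C, C = 4 * (2 / (1 - Real.exp (-2 * ρ₀)) * Real.exp (2 * R)) := ⟨_, rfl⟩
  have hC0 : 0 ≤ C := by rw [hC]; positivity
  have hcost : ∀ x y a s, IsDiscStep G x y a → a ≤ ε → x ∉ L → s ≤ d o x →
      KobayashiLE (G \ K) x y (a * (1 + C * Real.exp (-2 * s))) := by
    intro x y a s h ha hx hs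
    have hxG := h.mem_left
    -- Since `K` lies within distance `R` of `o`, a point `x ∉ L` with `d o x ≥ s` has distance at
    -- least `max ρ₀ (s - R)` from `K`. The shift by `R` is the source of the factor `exp (2 * R)`
    -- in `C`.
    have hρ : 0 < max ρ₀ (s - R) := lt_max_of_lt_left hρ₀
    have hle := (h.kobayashiLE_diff (K := K) hρ (fun q hq T hT hT' => ?_) ?_)
    · refine hle.mono ?_
      have h1 := inv_tanh_sub_one_le hρ₀ (le_max_left ρ₀ (s - R))
      have h2 : Real.exp (-2 * max ρ₀ (s - R)) ≤ Real.exp (2 * R) * Real.exp (-2 * s) := by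
        rw [← Real.exp_add]
        refine Real.exp_le_exp.2 ?_
        have := le_max_right ρ₀ (s - R)
        linarith
      have h3 : 2 / (1 - Real.exp (-2 * ρ₀)) * Real.exp (-2 * max ρ₀ (s - R)) ≤
          2 / (1 - Real.exp (-2 * ρ₀)) * (Real.exp (2 * R) * Real.exp (-2 * s)) := by gcongr
      refine mul_le_mul_of_nonneg_left ?_ h.1
      rw [hC]
      linarith
    · refine max_le (hfar x hx q hq T hT hT') ?_
      obtain ⟨_, hqG, _⟩ := id hT'
      have h1 := htri o ho q hqG x hxG
      have h2 := hdL q (hKL hq)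
      have h3 := (hd q hqG x hxG).2.2 T hT hT'.symm
      linarith
    · have h1 := tanh_le_self h.1
      have h2 := tanh_strictMono.monotone (le_max_left ρ₀ (s - R))
      linarith
  refine ⟨2 * (C * Real.exp (1 + R)) + (R' + R') + 1, by positivity,
    fun x hx y hy T hT hxy => ?_⟩
  obtain ⟨T', hchain, hT'⟩ : ∃ T', DiscChain G ε x y T' ∧ T' ≤ d x y + 1 := by
    obtain ⟨_, _, hle⟩ := (hd x hx.1 y hy.1).2.1
    obtain ⟨T', h, h'⟩ := exists_discChain_of_kobayashiEDist_lt hε0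
      (c := ENNReal.ofReal (d x y + 1)) (hle.trans_lt
      ((ENNReal.ofReal_lt_ofReal_iff (by linarith [(hd x hx.1 y hy.1).1])).2 (by linarith)))
    exact ⟨T', h, ((ENNReal.ofReal_lt_ofReal_iff_of_nonneg h.nonneg).1 h').le⟩
  obtain ⟨N, p, S, rfl, rfl, hS0, rfl, hmem, hstep⟩ := hchain.exists_seq
  have hsub := kobayashiLE_of_chain hmem (fun i hi => (hstep i hi).1)
  have hTle : d (p 0) (p N) ≤ T := (hd _ hx.1 _ hy.1).2.2 T hT hxy
  -- The whole chain exceeds the distance of its ends by at most `1`, and by the triangle inequality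
  -- so does every subchain.
  have hgeo : ∀ i j, i ≤ j → j ≤ N → S j - S i - 1 ≤ d (p i) (p j) := by
    intro i j hij hj
    have g0 := hmem 0 (by omega)
    have gi := hmem i (by omega)
    have gj := hmem j hj
    have gN := hmem N le_rfl
    have t1 := htri _ g0 _ gi _ gN
    have t2 := htri _ gi _ gj _ gN
    have s1 := hsub 0 i (by omega) (by omega)
    have s2 := hsub j N hj le_rfl
    have u1 := (hd _ g0 _ gi).2.2 _ s1.1 s1.2
    have u2 := (hd _ gj _ gN).2.2 _ s2.1 s2.2
    linarith
  have hmono : ∀ i j, i ≤ j → j ≤ N → S i ≤ S j := fun i j hij hj => by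
    linarith [(hsub i j hij hj).1]
  have hnear : ∀ i j, i ≤ N → j ≤ N → |S j - S i| - 1 ≤ d o (p i) + d o (p j) := by
    have aux : ∀ i j, i ≤ j → j ≤ N → S j - S i - 1 ≤ d o (p i) + d o (p j) := by
      intro i j hij hj
      have gi := hmem i (by omega)
      have gj := hmem j hj
      have h1 := hgeo i j hij hj
      have h2 := htri _ gi _ ho _ gj
      have h3 := hsymm _ gi _ ho
      linarith
    intro i j hi hj
    rcases le_total i j with h | h
    · rw [abs_of_nonneg (by linarith [hmono i j h hj])]
      exact aux i j h hj
    · rw [abs_of_nonpos (by linarith [hmono j i h hi])]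
      linarith [aux j i h hi]
  have hκ0 : ∀ i ≤ N, 0 ≤ d o (p i) := fun i hi => (hd o ho _ (hmem i hi)).1
  -- the chain leaves a suitable middle part linearly on both sides
  have hgrow : ∀ i j, i ≤ N → j ≤ N → (d o (p i) ≤ R ∨ d o (p i) ≤ d o (p j)) →
      (|S j - S i| - (1 + R)) / 2 ≤ d o (p j) := by
    intro i j hi hj h
    have h1 := hnear i j hi hj
    have h2 := hκ0 j hj
    rcases h with h | h
    · rcases le_total 0 (|S j - S i| - (1 + R)) with h3 | h3 <;> linarith
    · linarith
  have hstep_not_mem : ∀ x y a, IsDiscStep G x y a → a ≤ ε → x ∉ L → y ∉ K :=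
    fun x y a hs ha hxL hyK => by
      have := hfar x hxL y hyK a hs.1 hs.kobayashiLE
      linarith
  obtain ⟨i₀, j₀, hij, hjN, hi₀, hj₀, hmid, houti, houtj, hci, hcj⟩ : ∃ i₀ j₀, i₀ ≤ j₀ ∧ j₀ ≤ N ∧
      p i₀ ∈ G \ K ∧ p j₀ ∈ G \ K ∧ KobayashiLE (G \ K) (p i₀) (p j₀) (R' + R') ∧
      (∀ i < i₀, p i ∉ L) ∧ (∀ j, j₀ < j → j ≤ N → p j ∉ L) ∧
      (∀ i ≤ N, d o (p i₀) ≤ R ∨ d o (p i₀) ≤ d o (p i)) ∧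
      (∀ j ≤ N, d o (p j₀) ≤ R ∨ d o (p j₀) ≤ d o (p j)) := by
    by_cases hcase : ∃ i ≤ N, p i ∈ L
    · obtain ⟨i, hi, hiL⟩ := hcase
      have hF : ((Finset.range (N + 1)).filter fun i => p i ∈ L).Nonempty :=
        ⟨i, Finset.mem_filter.2 ⟨Finset.mem_range.2 (by omega), hiL⟩⟩
      obtain ⟨h1, h1L⟩ := Finset.mem_filter.1 (Finset.min'_mem _ hF)
      obtain ⟨h2, h2L⟩ := Finset.mem_filter.1 (Finset.max'_mem _ hF)
      have hmin : ∀ i ≤ N, p i ∈ L → Finset.min' _ hF ≤ i := fun i hi hiL =>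
        Finset.min'_le _ _ (Finset.mem_filter.2 ⟨Finset.mem_range.2 (by omega), hiL⟩)
      have hmax : ∀ i ≤ N, p i ∈ L → i ≤ Finset.max' _ hF := fun i hi hiL =>
        Finset.le_max' _ _ (Finset.mem_filter.2 ⟨Finset.mem_range.2 (by omega), hiL⟩)
      generalize Finset.min' _ hF = i₀ at *
      generalize Finset.max' _ hF = j₀ at *
      rw [Finset.mem_range] at h1 h2
      -- The first visit to `L` is not in `K`: either it is the initial point, or it is one short
      -- step away from a point outside `L`.
      have hi₀ : p i₀ ∈ G \ K := by
        refine ⟨hmem _ (by omega), ?_⟩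
        rcases Nat.eq_zero_or_pos i₀ with h | h
        · rw [h]
          exact hx.2
        · obtain ⟨hs, ha⟩ := hstep (i₀ - 1) (by omega)
          rw [Nat.sub_add_cancel h] at hs ha
          exact hstep_not_mem _ _ _ hs ha fun hL' => by
            have := hmin _ (by omega) hL'
            omega
      have hj₀ : p j₀ ∈ G \ K := by
        refine ⟨hmem _ (by omega), ?_⟩
        rcases Nat.eq_or_lt_of_le (Nat.lt_succ_iff.1 h2) with h | h
        · rw [h]
          exact hy.2
        · obtain ⟨hs, ha⟩ := hstep j₀ h
          exact hstep_not_mem _ _ _ hs.symm ha fun hL' => by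
            have := hmax _ (by omega) hL'
            omega
      refine ⟨i₀, j₀, hmin _ (by omega) h2L, by omega, hi₀, hj₀,
        (hLK _ ⟨h1L, hi₀.2⟩).symm.trans (hLK _ ⟨h2L, hj₀.2⟩) hR' hR', ?_, ?_,
        fun _ _ => Or.inl (hdL _ h1L), fun _ _ => Or.inl (hdL _ h2L)⟩
      · intro i hi hiL
        have := hmin i (by omega) hiL
        omega
      · intro j hj hjN hjL
        have := hmax j hjN hjL
        omega
    -- A chain that never meets `L` is cut at its point nearest to `o`, with a trivial middle part.
    · push Not at hcase
      obtain ⟨i₀, hi₀, hmin⟩ := Finset.exists_min_image (Finset.range (N + 1))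
        (fun i => d o (p i)) ⟨0, by simp⟩
      rw [Finset.mem_range] at hi₀
      have hmem₀ : p i₀ ∈ G \ K :=
        ⟨hmem _ (by omega), fun h => hcase i₀ (by omega) (hKL h)⟩
      have hmin' : ∀ i ≤ N, d o (p i₀) ≤ R ∨ d o (p i₀) ≤ d o (p i) := fun i hi =>
        Or.inr (hmin i (Finset.mem_range.2 (by omega)))
      exact ⟨i₀, i₀, le_rfl, by omega, hmem₀, hmem₀,
        (KobayashiLE.refl hmem₀).mono (by linarith), fun i hi => hcase i (by omega),
        fun j _ hj => hcase j hj, hmin', hmin'⟩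
  refine (kobayashiLE_of_split_chain (b := 1 + R) hC0 (add_nonneg hR' hR') hcost hmono hstep hij
    hjN hi₀ hj₀ hmid houti houtj ?_ ?_).mono (by linarith)
  · intro i hi
    have := hgrow i₀ i (by omega) (by omega) (hci i (by omega))
    rwa [abs_sub_comm, abs_of_nonneg (by linarith [hmono i i₀ hi.le (by omega)])] at this
  · intro j hj hjN'
    have := hgrow j₀ j hjN hjN' (hcj j hjN')
    rwa [abs_of_nonneg (by linarith [hmono j₀ j hj.le hjN'])] at this

/-- Compact subsets of `G` are bounded in `G \ closure D`, up to the boundary of `D`. -/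
theorem exists_kobayashiLE_diff_closure (hGo : IsOpen G) (hDo : IsOpen D)
    (hDG : closure D ⊆ G) (hc : IsPreconnected (G \ closure D))
    (hlevi : ∀ p ∈ frontier D, LeviFormHasPositiveEigenvalue D p)
    {o : EuclideanSpace ℂ (Fin n)} (ho : o ∈ G \ closure D) (hL : IsCompact L) (hLG : L ⊆ G) :
    ∃ R, 0 ≤ R ∧ ∀ x ∈ L \ closure D, KobayashiLE (G \ closure D) o x R := by
  have hGDo : IsOpen (G \ closure D) := hGo.sdiff isClosed_closure
  have ha : 0 ≤ Real.artanh (1 / 2) := Real.artanh_nonneg (by norm_num)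
  refine hL.induction_on
    (p := fun L => ∃ R, 0 ≤ R ∧ ∀ x ∈ L \ closure D, KobayashiLE (G \ closure D) o x R)
    ⟨0, le_rfl, by simp⟩ ?_ ?_ ?_
  · rintro s t hst ⟨R, hR, h⟩
    exact ⟨R, hR, fun q hq => h q ⟨hst hq.1, hq.2⟩⟩
  · rintro s t ⟨R, hR, h⟩ ⟨R', hR', h'⟩
    refine ⟨max R R', le_max_of_le_left hR, ?_⟩
    rintro q ⟨hq | hq, hqD⟩
    · exact (h q ⟨hq, hqD⟩).mono (le_max_left _ _)
    · exact (h' q ⟨hq, hqD⟩).mono (le_max_right _ _)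
  · intro p hp
    suffices h : ∃ t ∈ 𝓝 p, ∃ R, 0 ≤ R ∧ ∀ x ∈ t \ closure D, KobayashiLE (G \ closure D) o x R by
      obtain ⟨t, ht, h⟩ := h
      exact ⟨t, mem_nhdsWithin_of_mem_nhds ht, h⟩
    by_cases hpD : p ∈ closure D
    · by_cases hpD' : p ∈ D
      · exact ⟨D, hDo.mem_nhds hpD', 0, le_rfl, fun x hx => absurd (subset_closure hx.1) hx.2⟩
      obtain ⟨c, ε, m, Q, Y, hε, -, hQ, hQs, hev⟩ := exists_exterior_discs
        (hlevi p (hDo.frontier_eq ▸ ⟨hpD, hpD'⟩)) (hGo.mem_nhds (hDG hpD))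
      obtain ⟨R, hR, hRQ⟩ := exists_kobayashiLE_of_isCompact hGDo hc ho hQ hQs
      refine ⟨_, hev, R + Real.artanh (1 / 2), by positivity, ?_⟩
      rintro x ⟨hx, hxD⟩
      obtain ⟨-, hdisc, hq⟩ := hx hxD
      -- The exterior disc at `x`, rescaled to the unit disc: the parameter `1 / 2` is `t = ε / 2`,
      -- whose image lies in `Q`. This bounds the distance to `Q` uniformly up to the boundary.
      let φ : ℂ → EuclideanSpace ℂ (Fin n) := fun ζ =>
        x + ((ε : ℂ) * ζ) • Y x + ((ε : ℂ) * ζ) ^ 2 • c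
      have hφ : Differentiable ℂ φ := by fun_prop
      have hm : MapsTo φ (ball 0 1) (G \ closure D) := by
        intro ζ hζ
        refine hdisc _ ?_
        rw [mem_ball_zero_iff] at hζ
        rw [norm_mul, Complex.norm_real, Real.norm_eq_abs, abs_of_pos hε]
        nlinarith
      have hhalf : ‖(1 / 2 : ℂ)‖ = 1 / 2 := by norm_num
      have hs := isDiscStep_artanh hφ.differentiableOn hm (α := 1 / 2) (by
        rw [mem_ball_zero_iff, hhalf]
        norm_num)
      have h0 : φ 0 = x := by simp [φ]
      have h1 : φ (1 / 2) ∈ Q := by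
        have e : (ε : ℂ) * (1 / 2) = ((ε / 2 : ℝ) : ℂ) := by
          push_cast
          ring
        simp only [φ]
        rw [e]
        exact hq
      rw [hhalf, h0] at hs
      exact (hRQ _ h1).trans hs.symm.kobayashiLE hR ha
    · obtain ⟨ρ, hρ, hb⟩ := Metric.nhds_basis_closedBall.mem_iff.1
        (hGDo.mem_nhds ⟨hLG hp, hpD⟩)
      obtain ⟨R, hR, h⟩ := exists_kobayashiLE_of_isCompact hGDo hc ho
        (isCompact_closedBall p ρ) hb
      exact ⟨_, closedBall_mem_nhds p hρ, R, hR, fun x hx => h x hx.1⟩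

end

/-! ### Connectedness of the difference, the additive bound and Gromov hyperbolicity -/

section

variable {n : ℕ} {G D : Set (EuclideanSpace ℂ (Fin n))}

theorem isConnected_diff_closure_of_levi (hn : 2 ≤ n) (hGo : IsOpen G) (hGc : IsConnected G)
    (hGb : Bornology.IsBounded G) (hDo : IsOpen D) (hDne : D.Nonempty)
    (hDc : IsCompact (closure D)) (hDG : closure D ⊆ G)
    (hlevi : ∀ p ∈ frontier D, LeviFormHasPositiveEigenvalue D p) :
    IsConnected (G \ closure D) := by
  refine ⟨?_, hGc.isPreconnected.diff_of_isPreconnected_compl hGo hDc hDG hDne.closure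
    (isPreconnected_compl_closure_of_levi hn hDo hDc hlevi)⟩
  -- If nothing remained, `G = closure D` would be open and closed, hence the whole unbounded space.
  by_contra h
  have hEq : G = closure D :=
    Subset.antisymm (sdiff_eq_empty.1 (not_nonempty_iff_eq_empty.1 h)) hDG
  have hclopen : IsClopen G := ⟨hEq ▸ isClosed_closure, hGo⟩
  have : Nontrivial (EuclideanSpace ℂ (Fin n)) :=
    Module.nontrivial_of_finrank_pos (R := ℂ) (by rw [finrank_euclideanSpace_fin]; omega)
  rw [hclopen.eq_univ hGc.nonempty] at hGb
  exact NormedSpace.unbounded_univ ℝ (EuclideanSpace ℂ (Fin n)) hGb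

/-- Removing the closure of `D` changes the Kobayashi distance by a bounded amount. -/
theorem exists_kobayashiDist_diff_closure_le (hGo : IsOpen G) (hGc : IsPreconnected G)
    (hGb : Bornology.IsBounded G) (hDo : IsOpen D) (hDc : IsCompact (closure D))
    (hDG : closure D ⊆ G) (hc : IsConnected (G \ closure D))
    (hlevi : ∀ p ∈ frontier D, LeviFormHasPositiveEigenvalue D p) :
    ∃ M, 0 ≤ M ∧ ∀ z w : (G \ closure D : Set (EuclideanSpace ℂ (Fin n))),
      kobayashiDist (G \ closure D) z w ≤
        kobayashiDist G (inclusion sdiff_subset z) (inclusion sdiff_subset w) + M := by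
  obtain ⟨o, ho⟩ := hc.nonempty
  obtain ⟨r, hr, hrG⟩ := hDc.exists_cthickening_subset_open hGo hDG
  obtain ⟨c, hc0, hdist⟩ := exists_mul_dist_le_of_kobayashiLE hGb
  have hL : IsCompact (cthickening r (closure D)) := hDc.cthickening
  obtain ⟨R, hR, hRL⟩ := exists_kobayashiLE_of_isCompact hGo hGc ho.1 hL hrG
  obtain ⟨R', hR', hRL'⟩ := exists_kobayashiLE_diff_closure hGo hDo hDG hc.isPreconnected hlevi ho
    hL hrG
  -- Outside `L` the Euclidean distance to `closure D` exceeds `r`, and boundedness of `G` turns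
  -- this into Kobayashi distance at least `c * r`.
  obtain ⟨M, hM, h⟩ := exists_kobayashiLE_diff_of_kobayashiLE (K := closure D) hGo hGc ho.1
    (self_subset_cthickening _) (mul_pos hc0 hr) hR hR'
    (fun x hx q hq T hT hxq => by
      have h1 := hdist x q T hxq hT
      have h2 : r < dist x q := by
        by_contra! h
        exact hx (mem_cthickening_of_dist_le x q r _ hq h)
      exact le_trans (by gcongr) h1) hRL hRL'
  refine ⟨M, hM, fun z w => ?_⟩
  have hnn := kobayashiDist_nonneg (inclusion sdiff_subset z : G) (inclusion sdiff_subset w)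
  exact (h z z.2 w w.2 _ hnn (kobayashiLE_kobayashiDist hGo hGc (inclusion sdiff_subset z)
    (inclusion sdiff_subset w))).kobayashiDist_le (add_nonneg hnn hM)

end

/-- Each Gromov product has two positive distance terms and one negative one, so it rises by at most
`2M` and falls by at most `M`; the defect grows by at most `3M`. -/
theorem IsGromovHyperbolic.of_le_of_le_add {X Y : Type*} {d : X → X → ℝ} {e : Y → Y → ℝ}
    {f : X → Y} {M : ℝ} (h : IsGromovHyperbolic e) (h1 : ∀ x y, e (f x) (f y) ≤ d x y)
    (h2 : ∀ x y, d x y ≤ e (f x) (f y) + M) : IsGromovHyperbolic d := by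
  obtain ⟨B, hB⟩ := h
  refine ⟨B + 3 * M, fun p q x w => ?_⟩
  have hu : ∀ a b, gromovProduct d a b w ≤ gromovProduct e (f a) (f b) (f w) + 2 * M := by
    intro a b
    unfold gromovProduct
    linarith [h1 a b, h2 a w, h2 w b]
  have hl : gromovProduct e (f p) (f q) (f w) - M ≤ gromovProduct d p q w := by
    unfold gromovProduct
    linarith [h2 p q, h1 p w, h1 w q]
  have := hB (f p) (f q) (f x) (f w)
  unfold gromovDefect at this ⊢
  have hm : min (gromovProduct d p x w) (gromovProduct d x q w) ≤
      min (gromovProduct e (f p) (f x) (f w)) (gromovProduct e (f x) (f q) (f w)) + 2 * M := by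
    rw [← min_add_add_right]
    exact min_le_min (hu p x) (hu x q)
  linarith

theorem proposition5 (n : ℕ) (hn : 2 ≤ n) (G D : Set (EuclideanSpace ℂ (Fin n)))
    (hG_open : IsOpen G) (hG_conn : IsConnected G) (hG_bdd : Bornology.IsBounded G)
    (hD_open : IsOpen D) (hD_conn : IsConnected D)
    (hD_compact : IsCompact (closure D)) (hDG : closure D ⊆ G)
    (hD_smooth : HasC2Boundary D)
    (hD_levi : ∀ p ∈ frontier D, LeviFormHasPositiveEigenvalue D p) :
    (IsOpen (G \ closure D) ∧ IsConnected (G \ closure D)) ∧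
    (IsDistance (kobayashiDist G) ∧ IsDistance (kobayashiDist (G \ closure D))) ∧
    QuasiIsometricallyEquivalent (kobayashiDist (G \ closure D))
      (fun z w : (G \ closure D : Set (EuclideanSpace ℂ (Fin n))) =>
        kobayashiDist G (Set.inclusion Set.sdiff_subset z) (Set.inclusion Set.sdiff_subset w)) ∧
    (IsGromovHyperbolic (kobayashiDist G) →
      IsGromovHyperbolic (kobayashiDist (G \ closure D))) := by
  have ho : IsOpen (G \ closure D) := hG_open.sdiff isClosed_closure
  have hc := isConnected_diff_closure_of_levi hn hG_open hG_conn hG_bdd hD_open hD_conn.nonempty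
    hD_compact hDG hD_levi
  obtain ⟨M, hM, hle⟩ := exists_kobayashiDist_diff_closure_le hG_open hG_conn.isPreconnected
    hG_bdd hD_open hD_compact hDG hc hD_levi
  have hge : ∀ z w : (G \ closure D : Set (EuclideanSpace ℂ (Fin n))),
      kobayashiDist G (Set.inclusion Set.sdiff_subset z) (Set.inclusion Set.sdiff_subset w) ≤
        kobayashiDist (G \ closure D) z w := fun z w =>
    ENNReal.toReal_mono (kobayashiEDist_ne_top ho hc.isPreconnected z w)
      (kobayashiEDist_mono sdiff_subset z w)
  -- The multiplicative constant is `1`; the additive one is `M + 1` because it must be strictly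
  -- positive and `M` may vanish.
  refine ⟨⟨ho, hc⟩, ⟨isDistance_kobayashiDist hG_open hG_conn.isPreconnected hG_bdd,
    isDistance_kobayashiDist ho hc.isPreconnected (hG_bdd.subset sdiff_subset)⟩,
    ⟨1, M + 1, one_pos, by linarith, fun z w => ?_⟩, fun h => h.of_le_of_le_add hge hle⟩
  have h1 := hle z w
  have h2 := hge z w
  simp only [id, inv_one, one_mul]
  constructor <;> linarith
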